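/- A partial permutation is a pair $(d,\sigma)$ where $d$ is a finite set of positive integers and $\sigma$ is a permutation of $d$; its cycle-type is the partition of $|d|$ formed by the lengths of all cycles of $\sigma$ (fixed points included). Let $\mathcal{B}_\infty$ be the $\mathbb{Z}$-algebra of infinite formal $\mathbb{Z}$-linear combinations of partial permutations, with product extending $(d,\sigma)\cdot(d',\sigma')=(d\cup d',\tilde\sigma\tilde\sigma')$, where $\tilde\sigma,\tilde\sigma'$ are the extensions of $\sigma,\sigma'$ to $d\cup d'$ by fixed points. For a partition $\lambda$ (possibly empty) let $\mathcal{PC}_\lambda$ be the sum of all partial permutations of cycle-type $\lambda$. For $i\ge 1$ let $$X_i=\sum_{1\le j<i}\big(\{j,i\},(j\ i)\big)\in\mathcal{B}_\infty ,$$ and for $k\ge 0$ let $h_k(X_1,X_2,\dots)=\sum_{i_1\le\dots\le i_k}X_{i_1}\cdots X_{i_k}$ be the complete symmetric function of degree $k$ evaluated at $X_1,X_2,\dots$. **Theorem.** There is a unique family of integers $(c^k_\lambda)$, indexed by integers $k\ge 0$ and partitions $\lambda$, such that for every $k\geq 0$ $$h_k(X_1,X_2,\dots)=\sum_\lambda c^k_\lambda\,\mathcal{PC}_\lambda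 .$$ Moreover, for any partition $\rho=(\rho_1,\dots,\rho_\ell)$ (possibly empty) and any integer $k\ge 1$, $$c^k_{\rho\cup 1}=\sum_{i=1}^{\ell}\rho_i\,c^{k-1}_{\rho\setminus(\rho_i)\cup(\rho_i+1)},$$ $$c^k_{\rho\cup 2}=\sum_{i=1}^{\ell}\rho_i\,c^{k-1}_{\rho\setminus(\rho_i)\cup(\rho_i+2)}+c^{k-1}_{\rho\cup(1,1)}+2\,c^{k-1}_{\rho\cup(1)}+c^{k-1}_{\rho},$$ and, for any integer $m\ge 3$, $$c^k_{\rho\cup m}=\sum_{i=1}^{\ell}\rho_i\,c^{k-1}_{\rho\setminus(\rho_i)\cup(\rho_i+m)}+\sum_{r+s=m,\ r,s\ge 1}c^{k-1}_{\rho\cup(r,s)}+2\,c^{k-1}_{\rho\cup(m-1)},$$ where $\cup$ and $\setminus$ denote union and removal of parts counted with multiplicity, and the sum over $r,s$ runs over ordered pairs. -/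

import Mathlib

open scoped BigOperators

/-- A partial permutation `(d, σ)`: a finite set `d` of positive integers together with a
permutation `σ` of `d`. -/
structure PartialPerm where
  dom : Finset ℕ+
  perm : Equiv.Perm dom

namespace PartialPerm

/-- The canonical continuation of `σ` by fixed points (here to all positive integers). -/
def ext (p : PartialPerm) : Equiv.Perm ℕ+ := Equiv.Perm.ofSubtype p.perm

theorem ext_of_notMem (p : PartialPerm) {x : ℕ+} (hx : x ∉ p.dom) : p.ext x = x :=
  Equiv.Perm.ofSubtype_apply_of_not_mem p.perm hx

theorem ext_mem_iff (p : PartialPerm) (x : ℕ+) : p.ext x ∈ p.dom ↔ x ∈ p.dom :=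
  Equiv.Perm.ofSubtype_apply_mem_iff_mem p.perm x

/-- The continuation of the permutation of `p` to a set containing the domain of `p` preserves
that set. -/
theorem ext_mem_iff_of_subset (p : PartialPerm) {s : Finset ℕ+} (h : p.dom ⊆ s) (x : ℕ+) :
    p.ext x ∈ s ↔ x ∈ s := by
  by_cases hx : x ∈ p.dom
  · exact ⟨fun _ => h hx, fun _ => h ((p.ext_mem_iff x).2 hx)⟩
  · rw [p.ext_of_notMem hx]

/-- A partial permutation is determined by its domain and the continuation of its permutation. -/
theorem eq_of_dom_ext {p q : PartialPerm} (hd : p.dom = q.dom) (he : p.ext = q.ext) : p = q := by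
  obtain ⟨d, σ⟩ := p
  obtain ⟨d', σ'⟩ := q
  simp only at hd
  subst hd
  congr 1
  exact Equiv.Perm.ofSubtype_injective he

/-- `(d, σ) · (d', σ') = (d ∪ d', σ̃ σ̃')`, where `σ̃`, `σ̃'` are the continuations to `d ∪ d'`. -/
instance : Mul PartialPerm where
  mul p q :=
    { dom := p.dom ∪ q.dom
      perm := (p.ext * q.ext).subtypePerm fun x => by
        rw [Equiv.Perm.mul_apply, p.ext_mem_iff_of_subset Finset.subset_union_left,
          q.ext_mem_iff_of_subset Finset.subset_union_right] }

/-- The unit is the empty partial permutation. -/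
instance : One PartialPerm where
  one := { dom := ∅, perm := 1 }

theorem mul_dom (p q : PartialPerm) : (p * q).dom = p.dom ∪ q.dom := rfl

theorem one_dom : (1 : PartialPerm).dom = ∅ := rfl

theorem one_ext : (1 : PartialPerm).ext = 1 := map_one _

theorem mul_ext (p q : PartialPerm) : (p * q).ext = p.ext * q.ext := by
  refine Equiv.Perm.ofSubtype_subtypePerm (p := (· ∈ p.dom ∪ q.dom)) (fun x => ?_) fun x hx => ?_
  · rw [Equiv.Perm.mul_apply, p.ext_mem_iff_of_subset Finset.subset_union_left,
      q.ext_mem_iff_of_subset Finset.subset_union_right]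
  by_contra h
  have h' : x ∉ p.dom ∧ x ∉ q.dom := by
    rw [Finset.mem_union, not_or] at h
    exact h
  exact hx (by rw [Equiv.Perm.mul_apply, q.ext_of_notMem h'.2, p.ext_of_notMem h'.1])

instance : Monoid PartialPerm where
  mul_assoc p q r := eq_of_dom_ext (by simp only [mul_dom, Finset.union_assoc])
    (by simp only [mul_ext, mul_assoc])
  one_mul p := eq_of_dom_ext (by simp only [mul_dom, one_dom, Finset.empty_union])
    (by simp only [mul_ext, one_ext, one_mul])
  mul_one p := eq_of_dom_ext (by simp only [mul_dom, one_dom, Finset.union_empty])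
    (by simp only [mul_ext, one_ext, mul_one])

theorem finite_dom_subset (d : Finset ℕ+) : {p : PartialPerm | p.dom ⊆ d}.Finite := by
  refine (Set.finite_range
    (fun x : (Σ s : d.powerset, Equiv.Perm s.1) => (⟨x.1.1, x.2⟩ : PartialPerm))).subset ?_
  rintro ⟨s, σ⟩ hs
  exact ⟨⟨⟨s, Finset.mem_powerset.2 hs⟩, σ⟩, rfl⟩

/-- A partial permutation has only finitely many factorizations into two factors. -/
theorem finite_factorizations (p : PartialPerm) :
    {x : PartialPerm × PartialPerm | x.1 * x.2 = p}.Finite := by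
  refine ((finite_dom_subset p.dom).prod (finite_dom_subset p.dom)).subset ?_
  rintro ⟨a, b⟩ (h : a * b = p)
  subst h
  exact ⟨Finset.subset_union_left, Finset.subset_union_right⟩

/-- The finite set of pairs `(a, b)` with `a * b = p`. -/
noncomputable def factorizations (p : PartialPerm) : Finset (PartialPerm × PartialPerm) :=
  (finite_factorizations p).toFinset

theorem mem_factorizations {p : PartialPerm} {x : PartialPerm × PartialPerm} :
    x ∈ p.factorizations ↔ x.1 * x.2 = p := by
  simp [factorizations]

/-- The cycle-type of `(d, σ)`: the multiset of the lengths of all the cycles of `σ` on `d`,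
fixed points included (`Equiv.Perm.partition` counts them as parts `1`). -/
noncomputable def type (p : PartialPerm) : Multiset ℕ := p.perm.partition.parts

/-- The partial permutation `({j, i}, (j i))`. -/
def transposition (j i : ℕ+) : PartialPerm where
  dom := {j, i}
  perm := Equiv.swap ⟨j, by simp⟩ ⟨i, by simp⟩

end PartialPerm

/-- The `ℤ`-algebra `𝓑_∞`: infinite formal `ℤ`-linear combinations of partial permutations,
an element being given by its coefficients. -/
def PartialPermAlgebra : Type := PartialPerm → ℤ

namespace PartialPermAlgebra

noncomputable instance : AddCommGroup PartialPermAlgebra :=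
  inferInstanceAs (AddCommGroup (PartialPerm → ℤ))

/-- The coefficient `[p] f` of the partial permutation `p` in `f`. -/
def coeff (f : PartialPermAlgebra) (p : PartialPerm) : ℤ := f p

/-- The element of `𝓑_∞` with given coefficients. -/
def ofCoeff (f : PartialPerm → ℤ) : PartialPermAlgebra := f

theorem coeff_ofCoeff (f : PartialPerm → ℤ) (p : PartialPerm) : (ofCoeff f).coeff p = f p := rfl

theorem ext_coeff {f g : PartialPermAlgebra} (h : ∀ p, f.coeff p = g.coeff p) : f = g := funext h

theorem coeff_add (f g : PartialPermAlgebra) (p : PartialPerm) :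
    (f + g).coeff p = f.coeff p + g.coeff p := rfl

theorem coeff_zero (p : PartialPerm) : (0 : PartialPermAlgebra).coeff p = 0 := rfl

open Classical in
/-- The basis-like element `p`, i.e. the partial permutation `p` viewed in `𝓑_∞`. -/
noncomputable def single (p : PartialPerm) : PartialPermAlgebra :=
  ofCoeff fun q => if q = p then 1 else 0

/-- The bilinear extension of the product of partial permutations. -/
noncomputable instance : Mul PartialPermAlgebra where
  mul f g := ofCoeff fun p => ∑ x ∈ p.factorizations, f.coeff x.1 * g.coeff x.2

noncomputable instance : One PartialPermAlgebra where
  one := single 1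

theorem coeff_mul (f g : PartialPermAlgebra) (p : PartialPerm) :
    (f * g).coeff p = ∑ x ∈ p.factorizations, f.coeff x.1 * g.coeff x.2 := rfl

open Classical in
theorem coeff_single (p q : PartialPerm) :
    (single p).coeff q = if q = p then 1 else 0 := by
  simp only [single, coeff_ofCoeff]

theorem coeff_one (q : PartialPerm) : (1 : PartialPermAlgebra).coeff q = (single 1).coeff q := rfl

protected theorem one_mul (f : PartialPermAlgebra) : 1 * f = f := by
  classical
  refine ext_coeff fun p => ?_
  rw [coeff_mul, Finset.sum_eq_single (1, p)]
  · simp [coeff_one, coeff_single]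
  · rintro ⟨a, b⟩ hab hne
    have h : a * b = p := PartialPerm.mem_factorizations.1 hab
    have ha : a ≠ 1 := by
      rintro rfl
      exact hne (by rw [← h, one_mul])
    simp [coeff_one, coeff_single, ha]
  · intro h
    exact absurd (PartialPerm.mem_factorizations.2 (one_mul p)) h

protected theorem mul_one (f : PartialPermAlgebra) : f * 1 = f := by
  classical
  refine ext_coeff fun p => ?_
  rw [coeff_mul, Finset.sum_eq_single (p, 1)]
  · simp [coeff_one, coeff_single]
  · rintro ⟨a, b⟩ hab hne
    have h : a * b = p := PartialPerm.mem_factorizations.1 hab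
    have hb : b ≠ 1 := by
      rintro rfl
      exact hne (by rw [← h, mul_one])
    simp [coeff_one, coeff_single, hb]
  · intro h
    exact absurd (PartialPerm.mem_factorizations.2 (mul_one p)) h

protected theorem mul_assoc (f g h : PartialPermAlgebra) : f * g * h = f * (g * h) := by
  refine ext_coeff fun p => ?_
  simp only [coeff_mul, Finset.sum_mul, Finset.mul_sum]
  rw [Finset.sum_sigma', Finset.sum_sigma']
  refine Finset.sum_nbij' (fun x => ⟨(x.2.1, x.2.2 * x.1.2), (x.2.2, x.1.2)⟩)
    (fun x => ⟨(x.1.1 * x.2.1, x.2.2), (x.1.1, x.2.1)⟩) ?_ ?_ ?_ ?_ ?_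
  · rintro ⟨⟨a, b⟩, ⟨c, d⟩⟩ hx
    simp only [Finset.mem_sigma, PartialPerm.mem_factorizations] at hx ⊢
    obtain ⟨h1, h2⟩ := hx
    exact ⟨by rw [← mul_assoc, h2, h1], trivial⟩
  · rintro ⟨⟨a, b⟩, ⟨c, d⟩⟩ hx
    simp only [Finset.mem_sigma, PartialPerm.mem_factorizations] at hx ⊢
    obtain ⟨h1, h2⟩ := hx
    exact ⟨by rw [mul_assoc, h2, h1], trivial⟩
  · rintro ⟨⟨a, b⟩, ⟨c, d⟩⟩ hx
    simp only [Finset.mem_sigma, PartialPerm.mem_factorizations] at hx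
    obtain ⟨h1, h2⟩ := hx
    subst h2
    rfl
  · rintro ⟨⟨a, b⟩, ⟨c, d⟩⟩ hx
    simp only [Finset.mem_sigma, PartialPerm.mem_factorizations] at hx
    obtain ⟨h1, h2⟩ := hx
    subst h2
    rfl
  · rintro ⟨⟨a, b⟩, ⟨c, d⟩⟩ hx
    exact mul_assoc _ _ _

noncomputable instance : Ring PartialPermAlgebra where
  __ := (inferInstance : AddCommGroup PartialPermAlgebra)
  mul_assoc := PartialPermAlgebra.mul_assoc
  one_mul := PartialPermAlgebra.one_mul
  mul_one := PartialPermAlgebra.mul_one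
  left_distrib f g h := ext_coeff fun p => by
    simp only [coeff_mul, coeff_add, mul_add, Finset.sum_add_distrib]
  right_distrib f g h := ext_coeff fun p => by
    simp only [coeff_mul, coeff_add, add_mul, Finset.sum_add_distrib]
  zero_mul f := ext_coeff fun p => by
    simp only [coeff_mul, coeff_zero, zero_mul, Finset.sum_const_zero]
  mul_zero f := ext_coeff fun p => by
    simp only [coeff_mul, coeff_zero, mul_zero, Finset.sum_const_zero]

/-- A family of elements of `𝓑_∞` can be summed when every partial permutation has a nonzero
coefficient in only finitely many members of the family. -/
def LocallyFinite {ι : Type} (f : ι → PartialPermAlgebra) : Prop :=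
  ∀ p : PartialPerm, {i | (f i).coeff p ≠ 0}.Finite

/-- The (possibly infinite) coefficientwise sum of a locally finite family. -/
noncomputable def infSum {ι : Type} (f : ι → PartialPermAlgebra) : PartialPermAlgebra :=
  ofCoeff fun p => ∑ᶠ i, (f i).coeff p

/-- The partial Jucys-Murphy element `X_i = ∑_{j < i} ({j, i}, (j i))`. -/
noncomputable def jucysMurphy (i : ℕ+) : PartialPermAlgebra :=
  ∑ j ∈ Finset.Ico 1 i, single (PartialPerm.transposition j i)

/-- The monomial `X_{i_1} X_{i_2} ⋯ X_{i_k}` attached to a sequence `i_1 ≤ i_2 ≤ ⋯ ≤ i_k`. -/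
noncomputable def monomial {k : ℕ} (i : Fin k →o ℕ+) : PartialPermAlgebra :=
  (List.ofFn fun t => jucysMurphy (i t)).prod

/-- The complete symmetric function `h_k(X_1, X_2, …)`: the sum of all the monomials
`X_{i_1} ⋯ X_{i_k}` with `i_1 ≤ ⋯ ≤ i_k`. -/
noncomputable def completeJM (k : ℕ) : PartialPermAlgebra :=
  infSum fun i : Fin k →o ℕ+ => monomial i

open Classical in
/-- `PC_λ`, the sum of all partial permutations of cycle-type `λ`. A partition is a finite
multiset of positive integers. The condition `|d| = |λ|` is implied by the one on cycle-types. -/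
noncomputable def PC (l : Multiset ℕ+) : PartialPermAlgebra :=
  ofCoeff fun p => if p.type = l.map (fun r : ℕ+ => (r : ℕ)) then 1 else 0

/-- `c k λ` are the coefficients `c^k_λ` of `h_k(X_1, X_2, …)` on the `PC_λ`:
`h_k(X_1, X_2, …) = ∑_λ c^k_λ PC_λ` for all `k`. -/
def IsClassExpansion (c : ℕ → Multiset ℕ+ → ℤ) : Prop :=
  ∀ k : ℕ, completeJM k = infSum fun l : Multiset ℕ+ => c k l • PC l

/-! The two infinite sums above are well defined. -/

theorem coeff_sum {ι : Type} (s : Finset ι) (f : ι → PartialPermAlgebra) (p : PartialPerm) :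
    (∑ i ∈ s, f i).coeff p = ∑ i ∈ s, (f i).coeff p :=
  Finset.sum_apply p s f

theorem coeff_zsmul (n : ℤ) (f : PartialPermAlgebra) (p : PartialPerm) :
    (n • f).coeff p = n * f.coeff p :=
  (Pi.smul_apply n (f : PartialPerm → ℤ) p).trans (smul_eq_mul _ _)

theorem mem_dom_of_coeff_jucysMurphy {i : ℕ+} {p : PartialPerm}
    (h : (jucysMurphy i).coeff p ≠ 0) : i ∈ p.dom := by
  classical
  rw [jucysMurphy, coeff_sum] at h
  obtain ⟨j, -, hj⟩ := Finset.exists_ne_zero_of_sum_ne_zero h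
  rw [coeff_single] at hj
  have hp : p = PartialPerm.transposition j i := by
    by_contra hne
    exact hj (if_neg hne)
  rw [hp]
  simp [PartialPerm.transposition]

theorem mem_dom_of_coeff_list_prod (L : List ℕ+) (p : PartialPerm)
    (h : ((L.map jucysMurphy).prod).coeff p ≠ 0) : ∀ i ∈ L, i ∈ p.dom := by
  induction L generalizing p with
  | nil => simp
  | cons a L ih =>
    rw [List.map_cons, List.prod_cons, coeff_mul] at h
    obtain ⟨⟨x, y⟩, hxy, hne⟩ := Finset.exists_ne_zero_of_sum_ne_zero h
    have hp : x * y = p := PartialPerm.mem_factorizations.1 hxy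
    intro i hi
    rw [← hp, PartialPerm.mul_dom, Finset.mem_union]
    rcases List.mem_cons.1 hi with rfl | hi
    · exact Or.inl (mem_dom_of_coeff_jucysMurphy (left_ne_zero_of_mul hne))
    · exact Or.inr (ih y (right_ne_zero_of_mul hne) i hi)

theorem locallyFinite_monomial (k : ℕ) :
    LocallyFinite fun i : Fin k →o ℕ+ => monomial i := by
  intro p
  have hfin : {g : Fin k → ℕ+ | ∀ t, g t ∈ p.dom}.Finite := by
    have := Set.Finite.pi (fun _ : Fin k => p.dom.finite_toSet)
    refine this.subset ?_
    intro g hg t _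
    exact hg t
  refine Set.Finite.of_finite_image (f := fun i : Fin k →o ℕ+ => (i : Fin k → ℕ+))
    (hfin.subset ?_) (fun a _ b _ hab => DFunLike.coe_injective hab)
  rintro _ ⟨i, hi, rfl⟩ t
  have hi' : ((((List.ofFn fun t => i t)).map jucysMurphy).prod).coeff p ≠ 0 := by
    rw [List.map_ofFn]
    exact hi
  exact mem_dom_of_coeff_list_prod _ p hi' (i t) (List.mem_ofFn.2 ⟨t, rfl⟩)

theorem locallyFinite_smul_PC (c : Multiset ℕ+ → ℤ) :
    LocallyFinite fun l : Multiset ℕ+ => c l • PC l := by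
  classical
  intro p
  refine Set.Subsingleton.finite ?_
  have key : ∀ l : Multiset ℕ+, (c l • PC l).coeff p ≠ 0 →
      p.type = l.map (fun r : ℕ+ => (r : ℕ)) := by
    intro l hl
    by_contra hne
    exact hl (by rw [coeff_zsmul, PC, coeff_ofCoeff, if_neg hne, mul_zero])
  intro a ha b hb
  exact Multiset.map_injective PNat.coe_injective ((key a ha).symm.trans (key b hb))

end PartialPermAlgebra

/-! Existence and uniqueness amount to this: the coefficient of a partial permutation in
$h_k(X_1,X_2,\dots)$ depends only on its cycle-type. Only the monomials with indices in the domain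
of $p$ contribute to the coefficient of $p$, so $h_k$ may be replaced by $h_k(X_1,\dots,X_n)$ with
$n$ large (`coeff_completeJM`). Let $s$ exchange $i$ and $i+1$, and let $t$ be the corresponding
partial transposition. Relabelling by $s$ sends $X_{i+1}$ to $X_i+t$ and $X_i$ to $X_{i+1}-t$, so it
preserves $X_{i+1}+X_i$ and $X_{i+1}X_i$. Since $h_k$ can be computed recursively from these two
symmetric functions of consecutive variables, it is invariant under $s$, hence under all finitely
supported permutations (`relabel_ofSubtype_completeJM`). The orbits of these on partial permutations
are the cycle-types (`eq_of_type_eq`).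

For the recursion, a partial permutation $p$ of type $\rho\cup m$ is chosen whose greatest point $n$
lies in a cycle of length $m$. From
$h_k(X_1,\dots,X_n)=h_k(X_1,\dots,X_{n-1})+h_{k-1}(X_1,\dots,X_n)X_n$, whose first summand does not
reach the point $n$, the coefficient of $p$ in $h_k$ is a sum over $j$ of coefficients of the $q$
with $q\cdot(\{j,n\},(j\ n))=p$ (`coeff_completeJM_succ`). If $j$ lies in another cycle, of length
$r$, the two cycles merge; this occurs for $r$ points $j$ and gives the first sum. If $j$ lies in
the cycle of $n$, that cycle splits. A piece of length one is a fixed point $j$ or $n$, which the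
domain of $q$ may contain or omit: this ambiguity (`mul_transposition_eq_iff`) produces the terms in
which $|\lambda|$ drops (`coeff_mul_transposition_split`). -/

namespace PartialPerm

/-! ### Relabelling of partial permutations -/

theorem apply_mem_iff_of_fixes_compl {d : Finset ℕ+} {g : Equiv.Perm ℕ+}
    (h : ∀ x, x ∉ d → g x = x) (x : ℕ+) : g x ∈ d ↔ x ∈ d := by
  by_cases hx : x ∈ d
  · refine ⟨fun _ => hx, fun _ => ?_⟩
    by_contra hg
    have := g.injective (h _ hg)
    rw [this] at hg
    exact hg hx
  · rw [h x hx]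

/-- The partial permutation with domain `d` obtained by restricting a permutation `g` of `ℕ+`
that fixes all points outside `d`. -/
def ofExt (d : Finset ℕ+) (g : Equiv.Perm ℕ+) (h : ∀ x, x ∉ d → g x = x) : PartialPerm where
  dom := d
  perm := g.subtypePerm (apply_mem_iff_of_fixes_compl h)

theorem ofExt_dom {d : Finset ℕ+} {g : Equiv.Perm ℕ+} (h : ∀ x, x ∉ d → g x = x) :
    (ofExt d g h).dom = d := rfl

theorem ofExt_ext {d : Finset ℕ+} {g : Equiv.Perm ℕ+} (h : ∀ x, x ∉ d → g x = x) :
    (ofExt d g h).ext = g := by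
  refine Equiv.Perm.ofSubtype_subtypePerm (p := (· ∈ d)) (apply_mem_iff_of_fixes_compl h)
    fun x hx => ?_
  by_contra hd
  exact hx (h x hd)

theorem transposition_dom (j i : ℕ+) : (transposition j i).dom = {j, i} := rfl

theorem transposition_ext (j i : ℕ+) : (transposition j i).ext = Equiv.swap j i := by
  unfold transposition ext
  exact Equiv.Perm.ofSubtype_swap_eq _ _

theorem transposition_comm (i j : ℕ+) : transposition i j = transposition j i :=
  eq_of_dom_ext (by simp only [transposition_dom, Finset.pair_comm])
    (by simp only [transposition_ext, Equiv.swap_comm])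

/-- Relabelling of the points by a permutation of `ℕ+`. -/
def relabel (σ : Equiv.Perm ℕ+) (p : PartialPerm) : PartialPerm :=
  ofExt (p.dom.map σ.toEmbedding) (σ * p.ext * σ⁻¹) fun x hx => by
    have : σ⁻¹ x ∉ p.dom := fun h => hx (Finset.mem_map.2 ⟨_, h, by simp⟩)
    rw [Equiv.Perm.mul_apply, Equiv.Perm.mul_apply, p.ext_of_notMem this]
    exact σ.apply_symm_apply x

theorem relabel_dom (σ : Equiv.Perm ℕ+) (p : PartialPerm) :
    (relabel σ p).dom = p.dom.map σ.toEmbedding := rfl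

theorem mem_relabel_dom {σ : Equiv.Perm ℕ+} {p : PartialPerm} {x : ℕ+} :
    x ∈ (relabel σ p).dom ↔ σ⁻¹ x ∈ p.dom := by
  rw [relabel_dom, Finset.mem_map_equiv]
  rfl

theorem relabel_ext (σ : Equiv.Perm ℕ+) (p : PartialPerm) :
    (relabel σ p).ext = σ * p.ext * σ⁻¹ := ofExt_ext _

theorem relabel_mul (σ : Equiv.Perm ℕ+) (p q : PartialPerm) :
    relabel σ (p * q) = relabel σ p * relabel σ q := by
  refine eq_of_dom_ext ?_ ?_
  · simp only [relabel_dom, mul_dom, Finset.map_union]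
  · simp only [relabel_ext, mul_ext]
    group

theorem relabel_relabel (σ τ : Equiv.Perm ℕ+) (p : PartialPerm) :
    relabel σ (relabel τ p) = relabel (σ * τ) p := by
  refine eq_of_dom_ext ?_ ?_
  · ext x
    simp only [mem_relabel_dom, mul_inv_rev, Equiv.Perm.mul_apply]
  · simp only [relabel_ext]
    group

theorem relabel_one (p : PartialPerm) : relabel 1 p = p := by
  refine eq_of_dom_ext ?_ ?_
  · ext x
    simp only [mem_relabel_dom, inv_one, Equiv.Perm.one_apply]
  · simp [relabel_ext]

theorem relabel_inv_relabel (σ : Equiv.Perm ℕ+) (p : PartialPerm) :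
    relabel σ⁻¹ (relabel σ p) = p := by
  rw [relabel_relabel, inv_mul_cancel, relabel_one]

theorem relabel_relabel_inv (σ : Equiv.Perm ℕ+) (p : PartialPerm) :
    relabel σ (relabel σ⁻¹ p) = p := by
  rw [relabel_relabel, mul_inv_cancel, relabel_one]

theorem relabel_unit (σ : Equiv.Perm ℕ+) : relabel σ 1 = 1 := by
  refine eq_of_dom_ext ?_ ?_
  · rw [relabel_dom, one_dom, Finset.map_empty]
  · rw [relabel_ext, one_ext]
    simp

theorem relabel_transposition (σ : Equiv.Perm ℕ+) (j i : ℕ+) :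
    relabel σ (transposition j i) = transposition (σ j) (σ i) := by
  refine eq_of_dom_ext ?_ ?_
  · simp [relabel_dom, transposition_dom]
  · rw [relabel_ext, transposition_ext, transposition_ext, Equiv.swap_apply_apply]

/-- Moving a partial permutation across a product. -/
theorem relabel_ext_mul (p q : PartialPerm) : relabel p.ext q * p = p * q := by
  refine eq_of_dom_ext ?_ ?_
  -- The extension of `p` permutes `p.dom` and fixes every other point, so relabelling changes
  -- `q.dom` only inside `p.dom`.
  · ext x
    rw [mul_dom, mul_dom, Finset.mem_union, Finset.mem_union, mem_relabel_dom]
    by_cases hx : x ∈ p.dom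
    · simp [hx]
    · have : p.ext⁻¹ x = x := by
        rw [Equiv.Perm.inv_eq_iff_eq, p.ext_of_notMem hx]
      rw [this]
      tauto
  · rw [mul_ext, mul_ext, relabel_ext]
    group

end PartialPerm

/-! ### Jucys-Murphy elements under relabelling -/

namespace PartialPermAlgebra

open PartialPerm (transposition)

/-- Relabelling of the points, as an endomorphism of `𝓑_∞`. -/
noncomputable def relabel (σ : Equiv.Perm ℕ+) : PartialPermAlgebra →+* PartialPermAlgebra where
  -- Coefficients pull back: the inverse is what makes `single p` go to `single (p.relabel σ)`.
  toFun f := ofCoeff fun p => f.coeff (p.relabel σ⁻¹)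
  map_zero' := rfl
  map_add' _ _ := rfl
  map_one' := by
    classical
    refine ext_coeff fun p => ?_
    rw [coeff_ofCoeff, coeff_one, coeff_one, coeff_single, coeff_single]
    refine if_congr ⟨fun h => ?_, fun h => ?_⟩ rfl rfl
    · rw [← p.relabel_relabel_inv σ, h, PartialPerm.relabel_unit]
    · rw [h, PartialPerm.relabel_unit]
  map_mul' f g := by
    refine ext_coeff fun p => ?_
    rw [coeff_ofCoeff, coeff_mul, coeff_mul]
    refine Finset.sum_nbij' (fun x => (x.1.relabel σ, x.2.relabel σ))
      (fun x => (x.1.relabel σ⁻¹, x.2.relabel σ⁻¹)) ?_ ?_ ?_ ?_ ?_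
    · intro x hx
      rw [PartialPerm.mem_factorizations] at hx ⊢
      rw [← PartialPerm.relabel_mul, hx, PartialPerm.relabel_relabel_inv]
    · intro x hx
      rw [PartialPerm.mem_factorizations] at hx ⊢
      rw [← PartialPerm.relabel_mul, hx]
    · intro x _
      simp only [PartialPerm.relabel_inv_relabel]
    · intro x _
      simp only [PartialPerm.relabel_relabel_inv]
    · intro x _
      simp only [coeff_ofCoeff, PartialPerm.relabel_inv_relabel]

theorem coeff_relabel (σ : Equiv.Perm ℕ+) (f : PartialPermAlgebra) (p : PartialPerm) :
    (relabel σ f).coeff p = f.coeff (p.relabel σ⁻¹) := rfl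

theorem relabel_single (σ : Equiv.Perm ℕ+) (p : PartialPerm) :
    relabel σ (single p) = single (p.relabel σ) := by
  classical
  refine ext_coeff fun q => ?_
  rw [coeff_relabel, coeff_single, coeff_single]
  refine if_congr ⟨fun h => ?_, fun h => ?_⟩ rfl rfl
  · rw [← h, PartialPerm.relabel_relabel_inv]
  · rw [h, PartialPerm.relabel_inv_relabel]

/-- Substitute for conjugation, needed because a partial permutation with nonempty domain has no
inverse. -/
theorem single_mul_eq_relabel_mul (p : PartialPerm) (f : PartialPermAlgebra) :
    single p * f = relabel p.ext f * single p := by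
  classical
  refine ext_coeff fun r => ?_
  rw [coeff_mul, coeff_mul]
  refine Finset.sum_nbij' (fun x => (x.2.relabel x.1.ext, x.1))
    (fun x => (x.2, x.1.relabel x.2.ext⁻¹)) ?_ ?_ ?_ ?_ ?_
  · intro x hx
    rw [PartialPerm.mem_factorizations] at hx ⊢
    rw [← hx, PartialPerm.relabel_ext_mul]
  · intro x hx
    rw [PartialPerm.mem_factorizations] at hx ⊢
    rw [← hx, ← PartialPerm.relabel_ext_mul, PartialPerm.relabel_relabel_inv]
  · intro x _
    simp only [PartialPerm.relabel_inv_relabel]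
  · intro x _
    simp only [PartialPerm.relabel_relabel_inv]
  · intro x _
    simp only [coeff_relabel, coeff_single]
    split_ifs with h
    · rw [← h, PartialPerm.relabel_inv_relabel]
      ring
    · ring

theorem relabel_jucysMurphy {σ : Equiv.Perm ℕ+} {i : ℕ+} (hi : σ i = i)
    (h : ∀ x, σ x < i ↔ x < i) : relabel σ (jucysMurphy i) = jucysMurphy i := by
  rw [jucysMurphy, map_sum]
  refine Finset.sum_equiv σ (fun x => ?_) fun x _ => ?_
  · simp [h]
  · rw [relabel_single, PartialPerm.relabel_transposition, hi]

/-- The adjacent transposition exchanging `i` and `i + 1`. -/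
def adjSwap (i : ℕ+) : Equiv.Perm ℕ+ := Equiv.swap i (i + 1)

theorem relabel_adjSwap_jucysMurphy_succ (i : ℕ+) :
    relabel (adjSwap i) (jucysMurphy (i + 1)) =
      jucysMurphy i + single (transposition i (i + 1)) := by
  have hI : Finset.Ico 1 (i + 1) = insert i (Finset.Ico 1 i) := by
    ext x
    simp only [Finset.mem_Ico, Finset.mem_insert, one_le, true_and, PNat.lt_add_one_iff]
    exact le_iff_eq_or_lt
  have hs := PartialPerm.transposition_comm (i + 1) i
  rw [jucysMurphy, hI, Finset.sum_insert (by simp), map_add, relabel_single,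
    PartialPerm.relabel_transposition, adjSwap, Equiv.swap_apply_left, Equiv.swap_apply_right,
    add_comm, hs, map_sum, jucysMurphy]
  congr 1
  refine Finset.sum_congr rfl fun j hj => ?_
  have hj' : j < i := (Finset.mem_Ico.1 hj).2
  rw [relabel_single, PartialPerm.relabel_transposition, Equiv.swap_apply_right,
    Equiv.swap_apply_of_ne_of_ne hj'.ne (hj'.trans (PNat.lt_add_right i 1)).ne]

theorem relabel_relabel (σ τ : Equiv.Perm ℕ+) (f : PartialPermAlgebra) :
    relabel σ (relabel τ f) = relabel (σ * τ) f := by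
  refine ext_coeff fun p => ?_
  rw [coeff_relabel, coeff_relabel, coeff_relabel, PartialPerm.relabel_relabel, mul_inv_rev]

theorem relabel_one (f : PartialPermAlgebra) : relabel 1 f = f := by
  refine ext_coeff fun p => ?_
  rw [coeff_relabel, inv_one, PartialPerm.relabel_one]

theorem adjSwap_mul_self (i : ℕ+) : adjSwap i * adjSwap i = 1 := Equiv.swap_mul_self _ _

theorem relabel_adjSwap_jucysMurphy (i : ℕ+) :
    relabel (adjSwap i) (jucysMurphy i) =
      jucysMurphy (i + 1) - single (transposition i (i + 1)) := by
  have h := congrArg (relabel (adjSwap i)) (relabel_adjSwap_jucysMurphy_succ i)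
  rw [relabel_relabel, adjSwap_mul_self, relabel_one, map_add, relabel_single,
    PartialPerm.relabel_transposition, adjSwap, Equiv.swap_apply_left, Equiv.swap_apply_right] at h
  have hs := PartialPerm.transposition_comm (i + 1) i
  rw [h, hs, adjSwap, add_sub_cancel_right]

/-- Each transposition occurring in $X_j$ permutes the points below $i$ and fixes $i$, so
relabelling by it only permutes the summands of $X_i$. -/
theorem jucysMurphy_mul_comm {j i : ℕ+} (hji : j < i) :
    jucysMurphy j * jucysMurphy i = jucysMurphy i * jucysMurphy j := by
  rw [jucysMurphy.eq_1 j, Finset.sum_mul, Finset.mul_sum]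
  refine Finset.sum_congr rfl fun l hl => ?_
  have hl' : l < i := (Finset.mem_Ico.1 hl).2.trans hji
  rw [single_mul_eq_relabel_mul, PartialPerm.transposition_ext, relabel_jucysMurphy]
  · exact Equiv.swap_apply_of_ne_of_ne hl'.ne' hji.ne'
  · intro x
    rw [Equiv.swap_apply_def]
    split_ifs with h1 h2
    · simp [h1, hji, hl']
    · simp [h2, hji, hl']
    · rfl

theorem relabel_adjSwap_add (i : ℕ+) :
    relabel (adjSwap i) (jucysMurphy (i + 1) + jucysMurphy i) =
      jucysMurphy (i + 1) + jucysMurphy i := by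
  rw [map_add, relabel_adjSwap_jucysMurphy_succ, relabel_adjSwap_jucysMurphy]
  abel

/-- With $t$ the partial transposition of $i$ and $i+1$, one has $tX_{i+1}=(X_i+t)t$; hence in
$(X_i+t)(X_{i+1}-t)$ all terms containing $t$ cancel. -/
theorem relabel_adjSwap_mul (i : ℕ+) :
    relabel (adjSwap i) (jucysMurphy (i + 1) * jucysMurphy i) =
      jucysMurphy (i + 1) * jucysMurphy i := by
  have h := single_mul_eq_relabel_mul (transposition i (i + 1)) (jucysMurphy (i + 1))
  rw [PartialPerm.transposition_ext] at h
  change _ = relabel (adjSwap i) _ * _ at h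
  rw [relabel_adjSwap_jucysMurphy_succ] at h
  rw [map_mul, relabel_adjSwap_jucysMurphy_succ, relabel_adjSwap_jucysMurphy,
    ← jucysMurphy_mul_comm (PNat.lt_add_right i 1), mul_sub, add_mul, h]
  abel

/-! ### Invariance of the complete symmetric functions -/

theorem finite_orderHom_le (n k : ℕ) : {i : Fin k →o ℕ+ | ∀ t, (i t : ℕ) ≤ n}.Finite := by
  have hfin : {g : Fin k → ℕ+ | ∀ t, (g t : ℕ) ≤ n}.Finite := by
    have h : {a : ℕ+ | (a : ℕ) ≤ n}.Finite :=
      Set.Finite.of_finite_image (f := fun a : ℕ+ => (a : ℕ))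
        ((Set.finite_Iic n).subset (by rintro _ ⟨a, ha, rfl⟩; exact ha))
        PNat.coe_injective.injOn
    refine (Set.Finite.pi fun _ : Fin k => h).subset fun g hg t _ => hg t
  refine Set.Finite.of_finite_image (f := fun i : Fin k →o ℕ+ => (i : Fin k → ℕ+))
    (hfin.subset ?_) (fun a _ b _ hab => DFunLike.coe_injective hab)
  rintro _ ⟨i, hi, rfl⟩ t
  exact hi t

/-- The complete symmetric function `h_k(X_1, …, X_n)`. -/
noncomputable def truncJM (n k : ℕ) : PartialPermAlgebra :=
  ∑ i ∈ (finite_orderHom_le n k).toFinset, monomial i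

theorem truncJM_zero_right (n : ℕ) : truncJM n 0 = 1 := by
  have h : (finite_orderHom_le n 0).toFinset = {⟨Fin.elim0, fun a => a.elim0⟩} := by
    ext i
    simp only [Set.Finite.mem_toFinset, Finset.mem_singleton]
    exact ⟨fun _ => OrderHom.ext _ _ (funext fun t => t.elim0), fun _ t => t.elim0⟩
  rw [truncJM, h, Finset.sum_singleton]
  rfl

theorem truncJM_zero_left (k : ℕ) : truncJM 0 (k + 1) = 0 := by
  have h : (finite_orderHom_le 0 (k + 1)).toFinset = ∅ := by
    ext i
    simp
  rw [truncJM.eq_1, h, Finset.sum_empty]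

/-- Removal of the last term of a monotone sequence. -/
def orderHomInit {k : ℕ} (i : Fin (k + 1) →o ℕ+) : Fin k →o ℕ+ where
  toFun t := i t.castSucc
  monotone' _ _ h := i.monotone h

/-- Addition of a last term to a monotone sequence. -/
def orderHomSnoc {k : ℕ} (i : Fin k →o ℕ+) (a : ℕ+) (h : ∀ t, i t ≤ a) : Fin (k + 1) →o ℕ+ where
  toFun := Fin.snoc (α := fun _ => ℕ+) i a
  monotone' := by
    intro s t hst
    induction t using Fin.lastCases with
    | last =>
      induction s using Fin.lastCases with
      | last => exact le_rfl
      | cast s => simpa using h s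
    | cast t =>
      induction s using Fin.lastCases with
      | last =>
        exact absurd (lt_of_le_of_lt hst (Fin.castSucc_lt_last t)) (lt_irrefl _)
      | cast s => simpa using i.monotone (Fin.castSucc_le_castSucc_iff.1 hst)

theorem orderHomSnoc_last {k : ℕ} (i : Fin k →o ℕ+) (a : ℕ+) (h : ∀ t, i t ≤ a) :
    orderHomSnoc i a h (Fin.last k) = a := Fin.snoc_last (α := fun _ => ℕ+) a i

theorem orderHomSnoc_castSucc {k : ℕ} (i : Fin k →o ℕ+) (a : ℕ+) (h : ∀ t, i t ≤ a) (t : Fin k) :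
    orderHomSnoc i a h t.castSucc = i t := Fin.snoc_castSucc (α := fun _ => ℕ+) a i t

theorem monomial_eq_init_mul {k : ℕ} (i : Fin (k + 1) →o ℕ+) :
    monomial i = monomial (orderHomInit i) * jucysMurphy (i (Fin.last k)) := by
  rw [monomial, List.ofFn_succ', List.prod_concat]
  rfl

/-- Monotone sequences bounded by $n+1$ are sorted according to whether their last term is at most
$n$ or equal to $n+1$. -/
theorem truncJM_succ (n k : ℕ) :
    truncJM (n + 1) (k + 1) =
      truncJM n (k + 1) + truncJM (n + 1) k * jucysMurphy n.succPNat := by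
  classical
  rw [truncJM, ← Finset.sum_filter_add_sum_filter_not _ (fun i => (i (Fin.last k) : ℕ) ≤ n)]
  congr 1
  · refine Finset.sum_congr ?_ fun _ _ => rfl
    ext i
    simp only [Finset.mem_filter, Set.Finite.mem_toFinset, Set.mem_ofPred_eq]
    refine ⟨fun h t => ?_, fun h => ⟨fun t => (h t).trans n.le_succ, h _⟩⟩
    exact le_trans (PNat.coe_le_coe _ _ |>.2 (i.monotone (Fin.le_last t))) h.2
  · have hlast : ∀ i ∈ (finite_orderHom_le (n + 1) (k + 1)).toFinset.filter
        (fun i => ¬ (i (Fin.last k) : ℕ) ≤ n), i (Fin.last k) = n.succPNat := by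
      intro i hi
      simp only [Finset.mem_filter, Set.Finite.mem_toFinset, Set.mem_ofPred_eq] at hi
      apply PNat.coe_injective
      have := hi.1 (Fin.last k)
      have := hi.2
      rw [Nat.succPNat_coe]
      omega
    rw [truncJM, Finset.sum_mul]
    refine Finset.sum_nbij orderHomInit ?_ ?_ ?_ ?_
    · intro i hi
      simp only [Finset.mem_filter, Set.Finite.mem_toFinset, Set.mem_ofPred_eq] at hi ⊢
      exact fun t => hi.1 t.castSucc
    · intro i hi j hj hij
      refine OrderHom.ext _ _ (funext fun t => ?_)
      induction t using Fin.lastCases with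
      | last => rw [hlast i hi, hlast j hj]
      | cast t => exact DFunLike.congr_fun hij t
    · intro i hi
      simp only [Set.Finite.coe_toFinset, Set.mem_ofPred_eq] at hi
      refine ⟨orderHomSnoc i n.succPNat fun t => PNat.coe_le_coe _ _ |>.1 (hi t), ?_, ?_⟩
      · simp only [Finset.coe_filter, Set.Finite.mem_toFinset, Set.mem_ofPred_eq]
        constructor
        · intro t
          induction t using Fin.lastCases with
          | last => rw [orderHomSnoc_last, Nat.succPNat_coe]
          | cast t =>
            rw [orderHomSnoc_castSucc]
            exact hi t
        · rw [orderHomSnoc_last, Nat.succPNat_coe]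
          omega
      · refine OrderHom.ext _ _ (funext fun t => ?_)
        exact orderHomSnoc_castSucc i n.succPNat (fun t => PNat.coe_le_coe _ _ |>.1 (hi t)) t
    · intro i hi
      rw [monomial_eq_init_mul, hlast i hi]

/-- A monomial with nonzero coefficient at `p` has all its indices in `p.dom`. -/
theorem coeff_completeJM (k : ℕ) {n : ℕ} {p : PartialPerm} (hp : ∀ x ∈ p.dom, (x : ℕ) ≤ n) :
    (completeJM k).coeff p = (truncJM n k).coeff p := by
  rw [completeJM, infSum, coeff_ofCoeff, truncJM, coeff_sum]
  refine finsum_eq_sum_of_support_subset _ fun i hi => ?_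
  simp only [Set.Finite.coe_toFinset, Set.mem_ofPred_eq]
  intro t
  refine hp _ (mem_dom_of_coeff_list_prod (List.ofFn fun t => i t) p ?_ (i t)
    (List.mem_ofFn.2 ⟨t, rfl⟩))
  rw [List.map_ofFn]
  exact hi

theorem relabel_truncJM_of_fixes {σ : Equiv.Perm ℕ+} {n : ℕ} (h : ∀ x : ℕ+, (x : ℕ) ≤ n → σ x = x)
    (k : ℕ) : relabel σ (truncJM n k) = truncJM n k := by
  rw [truncJM, map_sum]
  refine Finset.sum_congr rfl fun i hi => ?_
  rw [Set.Finite.mem_toFinset] at hi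
  rw [monomial, map_list_prod, List.map_ofFn]
  congr 2
  funext t
  refine relabel_jucysMurphy (h _ (hi t)) fun x => ?_
  refine ⟨fun hx => ?_, fun hx => ?_⟩
  · have := h (σ x) (le_trans (PNat.coe_le_coe _ _ |>.2 hx.le) (hi t))
    rwa [σ.injective this] at hx
  · rwa [h x (le_trans (PNat.coe_le_coe _ _ |>.2 hx.le) (hi t))]

theorem truncJM_succ_mul (n k : ℕ) :
    truncJM (n + 1) k * jucysMurphy n.succPNat = truncJM (n + 1) (k + 1) - truncJM n (k + 1) := by
  rw [truncJM_succ, add_sub_cancel_left]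

/-- Elimination of two consecutive variables. -/
theorem truncJM_add_two (n k : ℕ) :
    truncJM (n + 2) (k + 2) = truncJM n (k + 2)
      + truncJM (n + 2) (k + 1) * (jucysMurphy (n + 1).succPNat + jucysMurphy n.succPNat)
      - truncJM (n + 2) k * (jucysMurphy (n + 1).succPNat * jucysMurphy n.succPNat) := by
  rw [mul_add, ← mul_assoc, truncJM_succ_mul (n + 1), truncJM_succ_mul (n + 1), sub_mul,
    truncJM_succ_mul n]
  abel

theorem truncJM_add_two_one (n : ℕ) :
    truncJM (n + 2) 1 = truncJM n 1
      + (jucysMurphy (n + 1).succPNat + jucysMurphy n.succPNat) := by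
  rw [truncJM_succ (n + 1) 0, truncJM_succ n 0, truncJM_zero_right, truncJM_zero_right, one_mul,
    one_mul]
  abel

theorem relabel_adjSwap_truncJM (n : ℕ) {i : ℕ+} (hi : (i : ℕ) + 1 ≤ n) (k : ℕ) :
    relabel (adjSwap i) (truncJM n k) = truncJM n k := by
  induction n generalizing k with
  | zero => omega
  | succ n ih =>
    rcases Nat.lt_or_ge (i : ℕ) n with hlt | hge
    -- Both exchanged points lie below the last index $n+1$, so the last variable is itself
    -- invariant.
    · induction k with
      | zero => rw [truncJM_zero_right, map_one]
      | succ k ihk =>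
        rw [truncJM_succ, map_add, map_mul, ih hlt, ihk, relabel_jucysMurphy]
        · apply Equiv.swap_apply_of_ne_of_ne <;>
          · intro h
            have := congrArg PNat.val h
            simp at this
            omega
        · intro x
          rw [adjSwap, Equiv.swap_apply_def]
          split_ifs with h1 h2
          · subst h1
            simp only [← PNat.coe_lt_coe, Nat.succPNat_coe, PNat.add_coe, PNat.one_coe]
            omega
          · subst h2
            simp only [← PNat.coe_lt_coe, Nat.succPNat_coe, PNat.add_coe, PNat.one_coe]
            omega
          · rfl
    -- Here the last two variables are exchanged. The recurrence of `truncJM_add_two` involves them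
    -- only through their sum and product, and refers back two degrees, hence the strong induction
    -- on `k` below.
    · obtain ⟨m, rfl⟩ : ∃ m, n = m + 1 := ⟨n - 1, by have := i.pos; omega⟩
      have hi1 : m.succPNat = i := PNat.coe_injective (by rw [Nat.succPNat_coe]; omega)
      have hi2 : (m + 1).succPNat = i + 1 :=
        PNat.coe_injective (by rw [Nat.succPNat_coe, PNat.add_coe, PNat.one_coe]; omega)
      have hfix : ∀ k, relabel (adjSwap i) (truncJM m k) = truncJM m k :=
        relabel_truncJM_of_fixes fun x hx => by
          apply Equiv.swap_apply_of_ne_of_ne <;>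
          · rintro rfl
            rw [← hi1] at hx
            simp at hx
      induction k using Nat.strong_induction_on with
      | _ k ihk =>
        match k with
        | 0 => rw [truncJM_zero_right, map_one]
        | 1 =>
          rw [truncJM_add_two_one, hi1, hi2, map_add, hfix, relabel_adjSwap_add]
        | k + 2 =>
          rw [truncJM_add_two, hi1, hi2, map_sub, map_add, map_mul, hfix, relabel_adjSwap_add,
            map_mul _ (truncJM (m + 2) k), relabel_adjSwap_mul, ihk k (by omega),
            ihk (k + 1) (by omega)]

theorem exists_dom_le (d : Finset ℕ+) : ∃ n : ℕ, ∀ x ∈ d, (x : ℕ) ≤ n :=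
  ⟨d.sup fun x => (x : ℕ), fun _ hx => Finset.le_sup (f := fun x : ℕ+ => (x : ℕ)) hx⟩

theorem relabel_adjSwap_completeJM (i : ℕ+) (k : ℕ) :
    relabel (adjSwap i) (completeJM k) = completeJM k := by
  refine ext_coeff fun p => ?_
  -- One truncation must serve for `p` and for its relabelling, and must contain both exchanged
  -- variables.
  obtain ⟨n, hn⟩ := exists_dom_le (p.dom ∪ (p.relabel (adjSwap i)⁻¹).dom ∪ {i + 1})
  rw [coeff_relabel, coeff_completeJM k (n := n), coeff_completeJM k (n := n), ← coeff_relabel,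
    relabel_adjSwap_truncJM]
  · exact hn (i + 1) (by simp)
  · exact fun x hx => hn x (by simp [hx])
  · exact fun x hx => hn x (by simp [hx])

theorem relabel_swap_completeJM (x y : ℕ+) (k : ℕ) :
    relabel (Equiv.swap x y) (completeJM k) = completeJM k := by
  wlog hxy : x ≤ y generalizing x y
  · rw [Equiv.swap_comm]
    exact this y x (not_le.1 hxy).le
  induction y using PNat.recOn with
  | one =>
    obtain rfl : x = 1 := le_antisymm hxy one_le
    rw [Equiv.swap_self]
    exact relabel_one _
  | succ y ih =>
    rcases eq_or_lt_of_le hxy with rfl | hlt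
    · rw [Equiv.swap_self]
      exact relabel_one _
    have hle : x ≤ y := PNat.lt_add_one_iff.1 hlt
    rcases eq_or_lt_of_le hle with rfl | hlt'
    · exact relabel_adjSwap_completeJM x k
    -- The transposition of $x$ and $y+1$ is the conjugate of that of $x$ and $y$ by the adjacent
    -- one.
    have h := Equiv.swap_apply_apply (adjSwap y) x y
    have h1 : adjSwap y x = x := Equiv.swap_apply_of_ne_of_ne hlt'.ne hlt.ne
    have h2 : adjSwap y y = y + 1 := Equiv.swap_apply_left _ _
    have h3 : (adjSwap y)⁻¹ = adjSwap y := inv_eq_of_mul_eq_one_left (adjSwap_mul_self y)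
    rw [h1, h2, h3] at h
    rw [h, ← relabel_relabel, ← relabel_relabel, relabel_adjSwap_completeJM, ih hle,
      relabel_adjSwap_completeJM]

theorem relabel_ofSubtype_completeJM (d : Finset ℕ+) (σ : Equiv.Perm d) (k : ℕ) :
    relabel (Equiv.Perm.ofSubtype σ) (completeJM k) = completeJM k := by
  induction σ using Equiv.Perm.swap_induction_on with
  | one => rw [map_one, relabel_one]
  | swap_mul f x y _ ih =>
    rw [map_mul, ← relabel_relabel, ih, Equiv.Perm.ofSubtype_swap_eq, relabel_swap_completeJM]

end PartialPermAlgebra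

/-! ### Cycle-types and the splitting off of a cycle -/

namespace PartialPerm

theorem type_sum (p : PartialPerm) : p.type.sum = p.dom.card := by
  rw [type, Nat.Partition.parts_sum, Fintype.card_coe]

/-- The extension of `p` by fixed points to a finite set containing its domain. -/
def restrict (p : PartialPerm) {s : Finset ℕ+} (h : p.dom ⊆ s) : Equiv.Perm s :=
  p.ext.subtypePerm (p.ext_mem_iff_of_subset h)

theorem coe_restrict_apply (p : PartialPerm) {s : Finset ℕ+} (h : p.dom ⊆ s) (x : s) :
    (p.restrict h x : ℕ+) = p.ext x := rfl

/-- Allows permutations of different domains to be compared inside one finite set; `cycleType` does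
not see the added fixed points. -/
theorem cycleType_restrict (p : PartialPerm) {s : Finset ℕ+} (h : p.dom ⊆ s) :
    (p.restrict h).cycleType = p.perm.cycleType := by
  let f : p.dom ≃ Subtype fun x : s => (x : ℕ+) ∈ p.dom :=
    (Equiv.subtypeSubtypeEquivSubtype fun {x} hx => h hx).symm
  have hf : p.restrict h = p.perm.extendDomain f := by
    ext x
    rw [coe_restrict_apply]
    by_cases hx : (x : ℕ+) ∈ p.dom
    · have hfx : x = (f ⟨x, hx⟩ : s) := rfl
      rw [hfx, Equiv.Perm.extendDomain_apply_image]
      exact Equiv.Perm.ofSubtype_apply_of_mem p.perm hx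
    · rw [Equiv.Perm.extendDomain_apply_not_subtype p.perm f (b := x) hx, p.ext_of_notMem hx]
  rw [hf, Equiv.Perm.cycleType_extendDomain]

theorem type_eq (p : PartialPerm) :
    p.type = p.perm.cycleType + Multiset.replicate (p.dom.card - p.perm.cycleType.sum) 1 := by
  rw [type, Equiv.Perm.parts_partition, Equiv.Perm.sum_cycleType, Fintype.card_coe]

theorem type_mul {p q : PartialPerm} (h : Disjoint p.dom q.dom) :
    (p * q).type = p.type + q.type := by
  have hp : p.dom ⊆ (p * q).dom := Finset.subset_union_left
  have hq : q.dom ⊆ (p * q).dom := Finset.subset_union_right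
  have hmul : (p * q).restrict subset_rfl = p.restrict hp * q.restrict hq := by
    ext x
    rw [Equiv.Perm.mul_apply, coe_restrict_apply, coe_restrict_apply, coe_restrict_apply, mul_ext,
      Equiv.Perm.mul_apply]
  have hdisj : (p.restrict hp).Disjoint (q.restrict hq) := by
    intro x
    by_cases hx : (x : ℕ+) ∈ p.dom
    · exact Or.inr (Subtype.ext (q.ext_of_notMem (Finset.disjoint_left.1 h hx)))
    · exact Or.inl (Subtype.ext (p.ext_of_notMem hx))
  have hct : (p * q).perm.cycleType = p.perm.cycleType + q.perm.cycleType := by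
    rw [← cycleType_restrict _ subset_rfl, hmul, hdisj.cycleType_mul, cycleType_restrict,
      cycleType_restrict]
  have h1 : p.perm.cycleType.sum ≤ p.dom.card := by
    simpa using p.perm.sum_cycleType_le
  have h2 : q.perm.cycleType.sum ≤ q.dom.card := by
    simpa using q.perm.sum_cycleType_le
  rw [type_eq, type_eq, type_eq, hct, mul_dom, Finset.card_union_of_disjoint h, Multiset.sum_add,
    show p.dom.card + q.dom.card - (p.perm.cycleType.sum + q.perm.cycleType.sum) =
      (p.dom.card - p.perm.cycleType.sum) + (q.dom.card - q.perm.cycleType.sum) by omega,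
    Multiset.replicate_add]
  abel

theorem type_one : (1 : PartialPerm).type = 0 := by
  have h : (1 : PartialPerm).perm.cycleType = 0 := Equiv.Perm.cycleType_one
  rw [type_eq, h, one_dom]
  rfl

/-- The partial permutation with domain the set of entries of `l` permuting them cyclically. -/
def cyc (l : List ℕ+) : PartialPerm :=
  ofExt l.toFinset l.formPerm fun _ hx =>
    List.formPerm_apply_of_notMem (fun h => hx (List.mem_toFinset.2 h))

theorem cyc_dom (l : List ℕ+) : (cyc l).dom = l.toFinset := rfl

theorem cyc_ext (l : List ℕ+) : (cyc l).ext = l.formPerm := ofExt_ext _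

theorem type_cyc {l : List ℕ+} (hl : l.Nodup) (hne : l ≠ []) : (cyc l).type = {l.length} := by
  have hcard : (cyc l).dom.card = l.length := by
    rw [cyc_dom, List.toFinset_card_of_nodup hl]
  have hpos : 0 < l.length := List.length_pos_iff.2 hne
  -- A list of length one gives a fixed point, absent from `cycleType` and counted only by the
  -- `replicate` term of `type_eq`.
  rcases Nat.lt_or_ge 1 l.length with h1 | h1
  · have hnt : (l.toFinset : Set ℕ+).Nontrivial := by
      rw [← Finset.Nontrivial, ← Finset.one_lt_card_iff_nontrivial, ← cyc_dom, hcard]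
      exact h1
    have hc : (cyc l).perm.IsCycle := by
      have hon : l.formPerm.IsCycleOn (l.toFinset : Set ℕ+) := by
        simpa using hl.isCycleOn_formPerm
      exact hon.isCycle_subtypePerm hnt
    have hs : (cyc l).perm.support = Finset.univ := by
      refine Finset.eq_univ_of_forall fun x => ?_
      rw [Equiv.Perm.mem_support]
      intro h
      have := congrArg Subtype.val h
      exact (List.formPerm_apply_mem_ne_self_iff l hl x.1 (List.mem_toFinset.1 x.2)).2 h1 this
    have hct : (cyc l).perm.cycleType = {l.length} := by
      rw [hc.cycleType, hs, Finset.card_univ, Fintype.card_coe, hcard]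
    rw [type_eq, hct, hcard]
    simp
  · have hsub : Subsingleton (cyc l).dom := by
      rw [← Fintype.card_le_one_iff_subsingleton, Fintype.card_coe, hcard]
      exact h1
    have hct : (cyc l).perm.cycleType = 0 := by
      rw [Equiv.Perm.cycleType_eq_zero]
      exact Subsingleton.elim _ _
    rw [type_eq, hct, hcard, show l.length = 1 by omega]
    simp

theorem type_relabel (σ : Equiv.Perm ℕ+) {s : Finset ℕ+} (τ : Equiv.Perm s)
    (hσ : σ = Equiv.Perm.ofSubtype τ) {p : PartialPerm} (hp : p.dom ⊆ s) :
    (p.relabel σ).type = p.type := by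
  have hmem : ∀ x, σ x ∈ s ↔ x ∈ s := by
    rw [hσ]
    exact Equiv.Perm.ofSubtype_apply_mem_iff_mem τ
  have hq : (p.relabel σ).dom ⊆ s := by
    intro x hx
    rw [mem_relabel_dom] at hx
    have := (hmem _).2 (hp hx)
    rwa [show σ (σ⁻¹ x) = x from σ.apply_symm_apply x] at this
  have hconj : (p.relabel σ).restrict hq = τ * p.restrict hp * τ⁻¹ := by
    ext x
    rw [coe_restrict_apply, relabel_ext, Equiv.Perm.mul_apply, Equiv.Perm.mul_apply,
      Equiv.Perm.mul_apply, Equiv.Perm.mul_apply, hσ, ← map_inv, Equiv.Perm.ofSubtype_apply_coe,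
      ← coe_restrict_apply p hp, Equiv.Perm.ofSubtype_apply_coe]
  have hct : (p.relabel σ).perm.cycleType = p.perm.cycleType := by
    rw [← cycleType_restrict _ hq, hconj, Equiv.Perm.cycleType_conj, cycleType_restrict]
  rw [type_eq, type_eq, hct, relabel_dom, Finset.card_map]

/-- A function invariant under relabelling by finitely supported permutations only depends on
the cycle-type. -/
theorem eq_of_type_eq {α : Type*} {f : PartialPerm → α}
    (hf : ∀ (s : Finset ℕ+) (σ : Equiv.Perm s) (p : PartialPerm),
      f (p.relabel (Equiv.Perm.ofSubtype σ)) = f p)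
    {p q : PartialPerm} (h : p.type = q.type) : f p = f q := by
  have hcard : p.dom.card = q.dom.card := by rw [← type_sum, ← type_sum, h]
  have hp : p.dom ⊆ p.dom ∪ q.dom := Finset.subset_union_left
  have hq : q.dom ⊆ p.dom ∪ q.dom := Finset.subset_union_right
  -- A bijection between the two domains, extended to a permutation of their union, reduces the
  -- claim to equal domains.
  let e : {x : ↥(p.dom ∪ q.dom) // (x : ℕ+) ∈ p.dom} ≃ {x : ↥(p.dom ∪ q.dom) // (x : ℕ+) ∈ q.dom} :=
    ((Equiv.subtypeSubtypeEquivSubtype fun {x} hx => hp hx).trans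
      (Finset.equivOfCardEq hcard)).trans
      (Equiv.subtypeSubtypeEquivSubtype fun {x} hx => hq hx).symm
  let τ : Equiv.Perm ↥(p.dom ∪ q.dom) := e.extendSubtype
  let r : PartialPerm := p.relabel (Equiv.Perm.ofSubtype τ)
  have hr : f r = f p := hf _ τ p
  have htype : r.type = q.type := (type_relabel _ τ rfl hp).trans h
  have hdom : r.dom = q.dom := by
    refine Finset.eq_of_subset_of_card_le ?_ ?_
    · intro x hx
      obtain ⟨y, hy, rfl⟩ := Finset.mem_map.1 hx
      have hy' := Equiv.Perm.ofSubtype_apply_of_mem τ (hp hy)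
      change Equiv.Perm.ofSubtype τ y ∈ q.dom
      rw [hy']
      exact e.extendSubtype_mem ⟨y, hp hy⟩ hy
    · rw [show r.dom.card = p.dom.card from Finset.card_map _, hcard]
  rw [← hr]
  clear_value r
  clear hr
  obtain ⟨d, ρ⟩ := r
  obtain ⟨d', ρ'⟩ := q
  obtain rfl : d = d' := hdom
  -- On a common domain, equal cycle-types mean conjugate permutations, and conjugation is a
  -- relabelling that preserves the domain.
  have hconj : IsConj ρ ρ' := by
    rw [Equiv.Perm.partition_eq_of_isConj]
    exact Nat.Partition.ext htype
  obtain ⟨c, hc⟩ := isConj_iff.1 hconj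
  rw [← hf d c ⟨d, ρ⟩]
  congr 1
  refine eq_of_dom_ext ?_ ?_
  · ext x
    rw [mem_relabel_dom, ← map_inv]
    exact Equiv.Perm.ofSubtype_apply_mem_iff_mem _ x
  · rw [relabel_ext]
    change Equiv.Perm.ofSubtype c * Equiv.Perm.ofSubtype ρ * (Equiv.Perm.ofSubtype c)⁻¹ = _
    rw [← map_inv, ← map_mul, ← map_mul, hc]
    rfl

theorem mul_comm_of_disjoint {p q : PartialPerm} (h : Disjoint p.dom q.dom) : p * q = q * p := by
  refine eq_of_dom_ext (by rw [mul_dom, mul_dom, Finset.union_comm]) ?_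
  rw [mul_ext, mul_ext]
  refine Equiv.Perm.Disjoint.commute fun x => ?_
  by_cases hx : x ∈ p.dom
  · exact Or.inr (q.ext_of_notMem (Finset.disjoint_left.1 h hx))
  · exact Or.inl (p.ext_of_notMem hx)

theorem formPerm_map_apply {α β : Type*} [DecidableEq α] [DecidableEq β] {f : α → β}
    (hf : Function.Injective f) (l : List α) (x : α) :
    (l.map f).formPerm (f x) = f (l.formPerm x) := by
  induction l generalizing x with
  | nil => simp
  | cons a l ih =>
    cases l with
    | nil => simp
    | cons b l =>
      rw [List.map_cons, List.map_cons, List.formPerm_cons_cons, List.formPerm_cons_cons,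
        Equiv.Perm.mul_apply, Equiv.Perm.mul_apply, ← List.map_cons, ih, hf.swap_apply]

theorem eq_mul_cyc (p : PartialPerm) {l : List ℕ+} (hsub : l.toFinset ⊆ p.dom)
    (h : ∀ x ∈ l, p.ext x = l.formPerm x) :
    ∃ p' : PartialPerm, Disjoint p'.dom l.toFinset ∧ p = p' * cyc l := by
  refine ⟨ofExt (p.dom \ l.toFinset) (p.ext * l.formPerm⁻¹) fun x hx => ?_, ?_, ?_⟩
  · rw [Equiv.Perm.mul_apply]
    by_cases hxl : x ∈ l
    · have hy : l.formPerm⁻¹ x ∈ l := by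
        rw [← List.formPerm_mem_iff_mem]
        rwa [show l.formPerm (l.formPerm⁻¹ x) = x from l.formPerm.apply_symm_apply x]
      rw [h _ hy]
      exact l.formPerm.apply_symm_apply x
    · have hxd : x ∉ p.dom := fun hd => hx (by simp [hd, hxl])
      have hinv : l.formPerm⁻¹ x = x := by
        rw [Equiv.Perm.inv_eq_iff_eq, List.formPerm_apply_of_notMem hxl]
      rw [hinv, p.ext_of_notMem hxd]
  · exact Finset.sdiff_disjoint
  · refine eq_of_dom_ext ?_ ?_
    · rw [mul_dom, ofExt_dom, cyc_dom, Finset.sdiff_union_of_subset hsub]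
    · rw [mul_ext, ofExt_ext, cyc_ext, inv_mul_cancel_right]

/-- Every point of the domain lies in a cycle that can be split off. -/
theorem exists_eq_mul_cyc (p : PartialPerm) {x : ℕ+} (hx : x ∈ p.dom) :
    ∃ (p' : PartialPerm) (l : List ℕ+), (x :: l).Nodup ∧ Disjoint p'.dom (x :: l).toFinset ∧
      p = p' * cyc (x :: l) := by
  let y : p.dom := ⟨x, hx⟩
  have hext : ∀ z : p.dom, p.ext z = p.perm z := fun z => Equiv.Perm.ofSubtype_apply_coe _ _
  -- `toList` of a fixed point is empty, so fixed points are treated apart, with the list `[x]`.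
  by_cases hfix : y ∈ p.perm.support
  · have hlen := Equiv.Perm.length_toList_pos_of_mem_support p.perm y hfix
    have hhead := Equiv.Perm.toList_getElem_zero p.perm y hfix
    obtain ⟨l, hl⟩ : ∃ l, p.perm.toList y = y :: l := by
      cases hL : p.perm.toList y with
      | nil => simp [hL] at hlen
      | cons a l =>
        simp only [hL, List.getElem_cons_zero] at hhead
        exact ⟨l, by rw [hhead]⟩
    have hnd : (y :: l).Nodup := hl ▸ Equiv.Perm.nodup_toList p.perm y
    have hmap : (y :: l).map Subtype.val = x :: l.map Subtype.val := rfl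
    obtain ⟨p', h1, h2⟩ := p.eq_mul_cyc (l := x :: l.map Subtype.val) (by
      rw [← hmap]
      intro z hz
      obtain ⟨w, -, rfl⟩ := List.mem_map.1 (List.mem_toFinset.1 hz)
      exact w.2) (by
      rw [← hmap]
      intro z hz
      obtain ⟨w, hw, rfl⟩ := List.mem_map.1 hz
      rw [formPerm_map_apply Subtype.val_injective, hext, ← hl, Equiv.Perm.formPerm_toList,
        Equiv.Perm.SameCycle.cycleOf_apply]
      rw [← hl, Equiv.Perm.mem_toList_iff] at hw
      exact hw.1)
    exact ⟨p', l.map Subtype.val, hmap ▸ hnd.map Subtype.val_injective, h1, h2⟩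
  · obtain ⟨p', h1, h2⟩ := p.eq_mul_cyc (l := [x]) (by simpa using hx) (by
      intro z hz
      rw [List.mem_singleton] at hz
      rw [hz, List.formPerm_singleton, hext y, Equiv.Perm.notMem_support.1 hfix]
      rfl)
    exact ⟨p', [], by simp, h1, h2⟩

end PartialPerm

/-! ### Cutting a cycle in two, and sums over the points of cycles -/

namespace PartialPerm

theorem formPerm_conj {α : Type*} [DecidableEq α] (σ : Equiv.Perm α) (l : List α) :
    σ * l.formPerm * σ⁻¹ = (l.map σ).formPerm := by
  rw [mul_inv_eq_iff_eq_mul]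
  ext x
  exact (formPerm_map_apply σ.injective l x).symm

theorem formPerm_append_cons {α : Type*} [DecidableEq α] (l₁ : List α) (b : α) (l₂ : List α) :
    (l₁ ++ b :: l₂).formPerm = (l₁ ++ [b]).formPerm * (b :: l₂).formPerm := by
  induction l₁ with
  | nil => simp
  | cons a l₁ ih =>
    cases l₁ with
    | nil => simp
    | cons c l₁ =>
      simp only [List.cons_append, List.formPerm_cons_cons] at ih ⊢
      rw [ih, mul_assoc]

/-- A cycle through `a` and `b` is the product of two cycles with the transposition of `a`, `b`. -/
theorem formPerm_split {α : Type*} [DecidableEq α] {a b : α} {l₁ l₂ : List α}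
    (h : (a :: (l₁ ++ b :: l₂)).Nodup) :
    (a :: (l₁ ++ b :: l₂)).formPerm =
      (b :: l₁).formPerm * (a :: l₂).formPerm * Equiv.swap a b := by
  simp only [List.nodup_cons, List.nodup_append, List.mem_append, List.mem_cons, not_or] at h
  obtain ⟨⟨ha1, hab, ha2⟩, h1, ⟨hb2, h2⟩, h12⟩ := h
  have hb1 : b ∉ l₁ := fun hb => h12 b hb b (Or.inl rfl) rfl
  have hconj : ∀ (x y : α) (l : List α), x ∉ l → y ∉ l →
      (y :: l).formPerm * Equiv.swap x y = Equiv.swap x y * (x :: l).formPerm := by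
    intro x y l hx hy
    have hl : l.map (Equiv.swap x y) = l := by
      conv_rhs => rw [← List.map_id l]
      refine List.map_congr_left fun z hz => ?_
      exact Equiv.swap_apply_of_ne_of_ne (fun hzx => hx (hzx ▸ hz)) (fun hzy => hy (hzy ▸ hz))
    have := formPerm_conj (Equiv.swap x y) (x :: l)
    rw [List.map_cons, hl, Equiv.swap_apply_left] at this
    rw [← this, Equiv.swap_inv, mul_assoc, Equiv.swap_mul_self, mul_one]
  have hrot : (a :: l₁ ++ [b]).formPerm = (b :: a :: l₁).formPerm := by
    have hnd : (b :: a :: l₁).Nodup := by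
      simp only [List.nodup_cons, List.mem_cons, not_or]
      exact ⟨⟨fun h => hab h.symm, hb1⟩, ha1, h1⟩
    exact (List.formPerm_eq_of_isRotated hnd ⟨1, by simp⟩).symm
  -- The cycle is cut at `b`, the first factor is rotated to begin with `b`, and the resulting
  -- transposition of `a` and `b` is moved to the right end; passing a cycle exchanges `a` and `b`
  -- in it.
  rw [← List.cons_append, formPerm_append_cons, hrot, List.formPerm_cons_cons, Equiv.swap_comm,
    ← hconj a b l₁ ha1 hb1, mul_assoc, mul_assoc, Equiv.swap_comm, hconj b a l₂ hb2 ha2]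

/-- The cycle-type as a multiset of positive integers. -/
noncomputable def ptype (p : PartialPerm) : Multiset ℕ+ :=
  p.type.pmap (fun n h => Nat.toPNat n h) fun _ h => p.perm.partition.parts_pos h

theorem map_ptype (p : PartialPerm) : p.ptype.map (fun r : ℕ+ => (r : ℕ)) = p.type := by
  rw [ptype, Multiset.map_pmap]
  exact (Multiset.pmap_eq_map _ id _ _).trans (Multiset.map_id _)

theorem ptype_eq_iff {p : PartialPerm} {l : Multiset ℕ+} :
    p.ptype = l ↔ p.type = l.map (fun r : ℕ+ => (r : ℕ)) := by
  rw [← map_ptype]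
  exact (Multiset.map_injective PNat.coe_injective).eq_iff.symm

theorem ptype_mul {p q : PartialPerm} (h : Disjoint p.dom q.dom) :
    (p * q).ptype = p.ptype + q.ptype := by
  rw [ptype_eq_iff, type_mul h, Multiset.map_add, map_ptype, map_ptype]

theorem ptype_cyc {x : ℕ+} {l : List ℕ+} (hl : (x :: l).Nodup) :
    (cyc (x :: l)).ptype = {l.length.succPNat} := by
  rw [ptype_eq_iff, type_cyc hl (List.cons_ne_nil _ _)]
  simp

theorem ptype_one : (1 : PartialPerm).ptype = 0 := by
  rw [ptype_eq_iff, type_one, Multiset.map_zero]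

theorem ptype_mul_cyc {p : PartialPerm} {x : ℕ+} {l : List ℕ+} (hl : (x :: l).Nodup)
    (h : Disjoint p.dom (x :: l).toFinset) :
    (p * cyc (x :: l)).ptype = p.ptype + {l.length.succPNat} := by
  rw [ptype_mul (by rwa [cyc_dom]), ptype_cyc hl]

/-- Supplies a cycle of prescribed length whose head is the greatest point of the whole domain, as
the extraction of the last variable requires. -/
theorem exists_fresh_list (d : Finset ℕ+) (m : ℕ) :
    ∃ (x : ℕ+) (l : List ℕ+), (x :: l).Nodup ∧ l.length = m ∧ Disjoint d (x :: l).toFinset ∧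
      ∀ y ∈ d ∪ (x :: l).toFinset, y ≤ x := by
  obtain ⟨N, hN⟩ := PartialPermAlgebra.exists_dom_le d
  have hmem : ∀ y ∈ (List.range m).map (fun i => (N + i).succPNat),
      N < (y : ℕ) ∧ (y : ℕ) < N + m + 1 := by
    intro y hy
    obtain ⟨i, hi, rfl⟩ := List.mem_map.1 hy
    rw [List.mem_range] at hi
    rw [Nat.succPNat_coe]
    omega
  refine ⟨(N + m).succPNat, (List.range m).map fun i => (N + i).succPNat, ?_, by simp, ?_, ?_⟩
  · refine List.nodup_cons.2 ⟨fun h => ?_, List.nodup_range.map fun i j hij => ?_⟩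
    · have := (hmem _ h).2
      rw [Nat.succPNat_coe] at this
      omega
    · have := Nat.succPNat_injective hij
      omega
  · refine Finset.disjoint_left.2 fun y hy hyl => ?_
    have h1 := hN y hy
    rw [List.mem_toFinset, List.mem_cons] at hyl
    rcases hyl with rfl | hyl
    · rw [Nat.succPNat_coe] at h1
      omega
    · have := (hmem y hyl).1
      omega
  · intro y hy
    rw [← PNat.coe_le_coe, Nat.succPNat_coe]
    rw [Finset.mem_union, List.mem_toFinset, List.mem_cons] at hy
    rcases hy with hy | rfl | hy
    · have := hN y hy
      omega
    · rw [Nat.succPNat_coe]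
    · have := (hmem y hy).2
      omega

theorem exists_ptype_eq (l : Multiset ℕ+) : ∃ p : PartialPerm, p.ptype = l := by
  induction l using Multiset.induction_on with
  | empty => exact ⟨1, ptype_one⟩
  | cons a s ih =>
    obtain ⟨p, hp⟩ := ih
    obtain ⟨x, l, hnd, hlen, hdisj, -⟩ := exists_fresh_list p.dom a.natPred
    refine ⟨p * cyc (x :: l), ?_⟩
    rw [ptype_mul_cyc hnd hdisj, hp, hlen, PNat.succPNat_natPred, ← Multiset.singleton_add,
      add_comm]

theorem exists_rotate_eq_cons {α : Type*} {l : List α} {x : α} (h : x ∈ l) :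
    ∃ l', (x :: l').IsRotated l := by
  obtain ⟨s, t, rfl⟩ := List.append_of_mem h
  exact ⟨t ++ s, by simpa using (List.isRotated_append (l := x :: t) (l' := s))⟩

theorem cyc_eq_of_isRotated {l l' : List ℕ+} (hl : l.Nodup) (h : l.IsRotated l') :
    cyc l = cyc l' := by
  refine eq_of_dom_ext ?_ ?_
  · ext x
    simp [cyc_dom, h.mem_iff]
  · rw [cyc_ext, cyc_ext, List.formPerm_eq_of_isRotated hl h]

theorem eq_one_of_dom_eq_empty {p : PartialPerm} (h : p.dom = ∅) : p = 1 := by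
  refine eq_of_dom_ext (h.trans one_dom.symm) ?_
  ext x
  rw [p.ext_of_notMem (by simp [h]), one_ext]
  rfl

/-- Summation over the domain of a function of the length of the cycle containing a point. -/
theorem sum_dom_eq (G : ℕ+ → ℤ) (φ : ℕ+ → ℤ) (p : PartialPerm)
    (h : ∀ (q : PartialPerm) (j : ℕ+) (l : List ℕ+), (j :: l).Nodup →
      Disjoint q.dom (j :: l).toFinset → p = q * cyc (j :: l) → φ j = G l.length.succPNat) :
    ∑ j ∈ p.dom, φ j = (p.ptype.map fun r : ℕ+ => (r : ℤ) * G r).sum := by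
  induction hn : p.dom.card using Nat.strong_induction_on generalizing p with
  | _ n ih =>
    rcases p.dom.eq_empty_or_nonempty with h0 | ⟨x, hx⟩
    · rw [eq_one_of_dom_eq_empty h0, ptype_one, one_dom]
      simp
    · obtain ⟨q, l, hnd, hdisj, rfl⟩ := p.exists_eq_mul_cyc hx
      have hcard : q.dom.card < n := by
        rw [← hn, mul_dom, cyc_dom, Finset.card_union_of_disjoint hdisj,
          List.toFinset_card_of_nodup hnd, List.length_cons]
        omega
      have hq : ∑ j ∈ q.dom, φ j = (q.ptype.map fun r : ℕ+ => (r : ℤ) * G r).sum := by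
        -- A cycle of `q` is also a cycle of the whole, since the disjoint factor `cyc (x :: l)`
        -- commutes with it.
        refine ih _ hcard q (fun q' j l' hnd' hdisj' hq' => ?_) rfl
        subst hq'
        rw [mul_dom, Finset.disjoint_union_left, cyc_dom] at hdisj
        refine h (q' * cyc (x :: l)) j l' hnd' ?_ ?_
        · rw [mul_dom, Finset.disjoint_union_left, cyc_dom]
          exact ⟨hdisj', hdisj.2.symm⟩
        · rw [mul_assoc, mul_assoc, mul_comm_of_disjoint
            (p := cyc (x :: l)) (q := cyc (j :: l')) hdisj.2.symm]
      -- Rotating the list lets any of its points serve as head without changing the length.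
      have hl : ∀ j ∈ (x :: l).toFinset, φ j = G l.length.succPNat := by
        intro j hj
        obtain ⟨l', hl'⟩ := exists_rotate_eq_cons (List.mem_toFinset.1 hj)
        have hlen : l'.length = l.length := by simpa using hl'.perm.length_eq
        rw [← hlen]
        refine h q j l' (hl'.nodup_iff.2 hnd) ?_ ?_
        · rwa [List.toFinset_eq_of_perm _ _ hl'.perm]
        · rw [cyc_eq_of_isRotated (hl'.nodup_iff.2 hnd) hl']
      rw [ptype_mul_cyc hnd hdisj, mul_dom, cyc_dom, Finset.sum_union hdisj, hq,
        Finset.sum_congr rfl hl, Finset.sum_const, List.toFinset_card_of_nodup hnd,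
        Multiset.map_add, Multiset.sum_add, Multiset.map_singleton, Multiset.sum_singleton]
      simp

/-- Applied to the points other than the head of a cycle: cutting at such a point gives pieces whose
lengths depend only on its position. -/
theorem sum_toFinset_eq_sum_range (Ψ : ℕ → ℕ → ℤ) (ψ : ℕ+ → ℤ) {l : List ℕ+} (hl : l.Nodup)
    (h : ∀ l₁ j l₂, l = l₁ ++ j :: l₂ → ψ j = Ψ l₁.length l₂.length) :
    ∑ j ∈ l.toFinset, ψ j = ∑ i ∈ Finset.range l.length, Ψ i (l.length - 1 - i) := by
  rw [List.sum_toFinset _ hl, ← Fin.sum_univ_fun_getElem, Finset.sum_range]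
  refine Finset.sum_congr rfl fun i _ => ?_
  rw [h (l.take i) l[(i : ℕ)] (l.drop (i + 1)) (by simp)]
  rw [List.length_take, List.length_drop, min_eq_left i.2.le]
  congr 1
  omega

end PartialPerm

/-! ### Existence and uniqueness of the class expansion -/

namespace PartialPermAlgebra

theorem coeff_completeJM_eq_of_type_eq (k : ℕ) {p q : PartialPerm} (h : p.type = q.type) :
    (completeJM k).coeff p = (completeJM k).coeff q := by
  refine PartialPerm.eq_of_type_eq (f := fun p => (completeJM k).coeff p) (fun s σ p => ?_) h
  conv_rhs => rw [← relabel_ofSubtype_completeJM s σ⁻¹ k, coeff_relabel, map_inv, inv_inv]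

/-- Each partial permutation occurs in exactly one $\mathcal{PC}_\lambda$, so the infinite sum has a
single contributing term at each `p`. -/
theorem isClassExpansion_iff {c : ℕ → Multiset ℕ+ → ℤ} :
    IsClassExpansion c ↔ ∀ k p, (completeJM k).coeff p = c k p.ptype := by
  have h : ∀ k p, (infSum fun l : Multiset ℕ+ => c k l • PC l).coeff p = c k p.ptype := by
    intro k p
    rw [infSum, coeff_ofCoeff, finsum_eq_single _ p.ptype]
    · rw [coeff_zsmul, PC, coeff_ofCoeff, if_pos p.map_ptype.symm, mul_one]
    · intro l hl
      rw [coeff_zsmul, PC, coeff_ofCoeff, if_neg, mul_zero]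
      exact fun hn => hl (PartialPerm.ptype_eq_iff.2 hn).symm
  refine ⟨fun hc k p => ?_, fun hc k => ext_coeff fun p => ?_⟩
  · rw [hc k, h]
  · rw [hc, h]

theorem existsUnique_isClassExpansion :
    ∃! c : ℕ → Multiset ℕ+ → ℤ, IsClassExpansion c := by
  choose P hP using PartialPerm.exists_ptype_eq
  refine ⟨fun k l => (completeJM k).coeff (P l), ?_, fun c hc => ?_⟩
  · refine isClassExpansion_iff.2 fun k p => coeff_completeJM_eq_of_type_eq k ?_
    rw [← PartialPerm.map_ptype, ← PartialPerm.map_ptype, hP]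
  · funext k l
    rw [isClassExpansion_iff.1 hc, hP]

end PartialPermAlgebra

/-! ### The last Jucys-Murphy element and division by a transposition -/

namespace PartialPermAlgebra

open PartialPerm (transposition cyc)

theorem dom_le_of_coeff_truncJM {n k : ℕ} {p : PartialPerm} (h : (truncJM n k).coeff p ≠ 0) :
    ∀ x ∈ p.dom, (x : ℕ) ≤ n := by
  classical
  induction n generalizing k p with
  | zero =>
    cases k with
    | zero =>
      rw [truncJM_zero_right, coeff_one, coeff_single] at h
      have hp : p = 1 := by
        by_contra hne
        exact h (if_neg hne)
      simp [hp, PartialPerm.one_dom]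
    | succ k =>
      rw [truncJM_zero_left] at h
      exact absurd rfl h
  | succ n ih =>
    induction k generalizing p with
    | zero =>
      rw [truncJM_zero_right, coeff_one, coeff_single] at h
      have hp : p = 1 := by
        by_contra hne
        exact h (if_neg hne)
      simp [hp, PartialPerm.one_dom]
    | succ k ihk =>
      rw [truncJM_succ, coeff_add] at h
      by_cases h1 : (truncJM n (k + 1)).coeff p = 0
      · rw [h1, zero_add, coeff_mul] at h
        obtain ⟨⟨q, r⟩, hqr, hne⟩ := Finset.exists_ne_zero_of_sum_ne_zero h
        rw [PartialPerm.mem_factorizations] at hqr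
        have hq := ihk (left_ne_zero_of_mul hne)
        have hr := right_ne_zero_of_mul hne
        rw [jucysMurphy, coeff_sum] at hr
        obtain ⟨j, hj, hjr⟩ := Finset.exists_ne_zero_of_sum_ne_zero hr
        rw [coeff_single] at hjr
        have hr' : r = transposition j n.succPNat := by
          by_contra hne
          exact hjr (if_neg hne)
        have hjn : (j : ℕ) < n + 1 := by
          have := PNat.coe_lt_coe _ _ |>.2 (Finset.mem_Ico.1 hj).2
          rwa [Nat.succPNat_coe] at this
        intro x hx
        rw [← hqr, PartialPerm.mul_dom, Finset.mem_union] at hx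
        rcases hx with hx | hx
        · exact hq x hx
        · simp only [hr', PartialPerm.transposition_dom, Finset.mem_insert,
            Finset.mem_singleton] at hx
          rcases hx with rfl | rfl
          · exact hjn.le
          · rw [Nat.succPNat_coe]
      · exact fun x hx => (ih h1 x hx).trans n.le_succ

/-- Extraction of the last Jucys-Murphy element at a partial permutation whose domain has
greatest element `n`. -/
theorem coeff_completeJM_succ (k : ℕ) {p : PartialPerm} {n : ℕ+} (hn : n ∈ p.dom)
    (hmax : ∀ x ∈ p.dom, x ≤ n) :
    (completeJM (k + 1)).coeff p =
      ∑ j ∈ p.dom.erase n, (completeJM k * single (transposition j n)).coeff p := by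
  classical
  obtain ⟨N, rfl⟩ : ∃ N : ℕ, n = N.succPNat := ⟨n.natPred, n.succPNat_natPred.symm⟩
  have hle : ∀ x ∈ p.dom, (x : ℕ) ≤ N + 1 := fun x hx => by
    have := PNat.coe_le_coe _ _ |>.2 (hmax x hx)
    rwa [Nat.succPNat_coe] at this
  have h0 : (truncJM N (k + 1)).coeff p = 0 := by
    by_contra h
    have := dom_le_of_coeff_truncJM h _ hn
    rw [Nat.succPNat_coe] at this
    omega
  -- The left factor in any factorization of `p` has its domain inside `p.dom`, where the truncation
  -- is invisible.
  have h1 : (truncJM (N + 1) k * jucysMurphy N.succPNat).coeff p =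
      (completeJM k * jucysMurphy N.succPNat).coeff p := by
    rw [coeff_mul, coeff_mul]
    refine Finset.sum_congr rfl fun x hx => ?_
    rw [PartialPerm.mem_factorizations] at hx
    rw [coeff_completeJM k (n := N + 1)]
    intro y hy
    refine hle y ?_
    rw [← hx, PartialPerm.mul_dom]
    exact Finset.mem_union_left _ hy
  rw [coeff_completeJM (k + 1) hle, truncJM_succ, coeff_add, h0, zero_add, h1, jucysMurphy,
    Finset.mul_sum, coeff_sum]
  symm
  -- A transposition moving a point outside `p.dom` cannot be a factor of `p`.
  refine Finset.sum_subset (fun j hj => ?_) fun j _ hj => ?_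
  · rw [Finset.mem_erase] at hj
    exact Finset.mem_Ico.2 ⟨one_le, lt_of_le_of_ne (hmax j hj.2) hj.1⟩
  · rename_i hjI
    rw [coeff_mul]
    refine Finset.sum_eq_zero fun x hx => ?_
    rw [PartialPerm.mem_factorizations] at hx
    rw [coeff_single, if_neg, mul_zero]
    intro hx2
    refine hj (Finset.mem_erase.2 ⟨(Finset.mem_Ico.1 hjI).2.ne, ?_⟩)
    rw [← hx, PartialPerm.mul_dom, hx2, PartialPerm.transposition_dom]
    simp

theorem coeff_mul_single (f : PartialPermAlgebra) {r p : PartialPerm} (Q : Finset PartialPerm)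
    (hQ : ∀ q, q ∈ Q ↔ q * r = p) : (f * single r).coeff p = ∑ q ∈ Q, f.coeff q := by
  classical
  rw [coeff_mul]
  symm
  refine Finset.sum_of_injOn (fun q => (q, r)) (fun a _ b _ h => (Prod.ext_iff.1 h).1) ?_ ?_ ?_
  · intro q hq
    exact PartialPerm.mem_factorizations.2 ((hQ q).1 hq)
  · rintro ⟨a, b⟩ hab hn
    rw [coeff_single, if_neg, mul_zero]
    rintro rfl
    exact hn ⟨a, (hQ a).2 (PartialPerm.mem_factorizations.1 hab), rfl⟩
  · intro q _
    rw [coeff_single, if_pos rfl, mul_one]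

/-- Cancellation determines the permutation but not the domain: a solution `q` may omit `j` or `n`,
provided that it fixes the omitted point. -/
theorem mul_transposition_eq_iff {q q₀ : PartialPerm} {j n : ℕ+} (hj : j ∈ q₀.dom)
    (hn : n ∈ q₀.dom) :
    q * transposition j n = q₀ * transposition j n ↔
      q.ext = q₀.ext ∧ q.dom ∪ {j, n} = q₀.dom := by
  have h0 : q₀.dom ∪ {j, n} = q₀.dom := by
    rw [Finset.union_eq_left]
    intro x hx
    rw [Finset.mem_insert, Finset.mem_singleton] at hx
    rcases hx with rfl | rfl <;> assumption
  constructor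
  · intro h
    have h1 := congrArg PartialPerm.ext h
    have h2 := congrArg PartialPerm.dom h
    rw [PartialPerm.mul_ext, PartialPerm.mul_ext] at h1
    rw [PartialPerm.mul_dom, PartialPerm.mul_dom, PartialPerm.transposition_dom, h0] at h2
    exact ⟨mul_right_cancel h1, h2⟩
  · rintro ⟨h1, h2⟩
    refine PartialPerm.eq_of_dom_ext ?_ ?_
    · rw [PartialPerm.mul_dom, PartialPerm.mul_dom, PartialPerm.transposition_dom, h0, h2]
    · rw [PartialPerm.mul_ext, PartialPerm.mul_ext, h1]

theorem mem_dom_of_ext_ne {p : PartialPerm} {x : ℕ+} (h : p.ext x ≠ x) : x ∈ p.dom := by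
  by_contra hx
  exact h (p.ext_of_notMem hx)

theorem cyc_singleton_ext (x : ℕ+) : (cyc [x]).ext = 1 := by
  rw [PartialPerm.cyc_ext, List.formPerm_singleton]

theorem mul_cyc_singleton_dom (u : PartialPerm) (x : ℕ+) : (u * cyc [x]).dom = insert x u.dom := by
  rw [PartialPerm.mul_dom, PartialPerm.cyc_dom]
  ext y
  simp

theorem mul_cyc_singleton_ext (u : PartialPerm) (x : ℕ+) : (u * cyc [x]).ext = u.ext := by
  rw [PartialPerm.mul_ext, cyc_singleton_ext, mul_one]

/-- Division by a transposition of two points that are moved. -/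
theorem coeff_mul_transposition_of_moves (f : PartialPermAlgebra) {q₀ : PartialPerm} {j n : ℕ+}
    (hj : q₀.ext j ≠ j) (hn : q₀.ext n ≠ n) :
    (f * single (transposition j n)).coeff (q₀ * transposition j n) = f.coeff q₀ := by
  rw [coeff_mul_single f {q₀}, Finset.sum_singleton]
  intro q
  rw [mul_transposition_eq_iff (mem_dom_of_ext_ne hj) (mem_dom_of_ext_ne hn),
    Finset.mem_singleton]
  constructor
  · rintro rfl
    exact (mul_transposition_eq_iff (mem_dom_of_ext_ne hj) (mem_dom_of_ext_ne hn)).1 rfl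
  · rintro ⟨h1, h2⟩
    refine PartialPerm.eq_of_dom_ext ?_ h1
    rw [← h2, eq_comm, Finset.union_eq_left]
    intro x hx
    rw [Finset.mem_insert, Finset.mem_singleton] at hx
    rw [← h1] at hj hn
    rcases hx with rfl | rfl
    · exact mem_dom_of_ext_ne hj
    · exact mem_dom_of_ext_ne hn

/-- Division by a transposition of two points the second of which is fixed. -/
theorem coeff_mul_transposition_of_fixes_right (f : PartialPermAlgebra) {u : PartialPerm}
    {j n : ℕ+} (hj : u.ext j ≠ j) (hn : n ∉ u.dom) :
    (f * single (transposition j n)).coeff (u * cyc [n] * transposition j n) =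
      f.coeff (u * cyc [n]) + f.coeff u := by
  classical
  have hjd := mem_dom_of_ext_ne hj
  have hne : u * cyc [n] ≠ u := fun h => hn (by
    rw [← h, mul_cyc_singleton_dom]
    exact Finset.mem_insert_self _ _)
  -- The moved point `j` is forced into the domain, while the fixed point `n` may be kept or
  -- omitted.
  rw [coeff_mul_single f {u * cyc [n], u}, Finset.sum_pair hne]
  intro q
  rw [mul_transposition_eq_iff (by simp [mul_cyc_singleton_dom, hjd])
    (by simp [mul_cyc_singleton_dom]), mul_cyc_singleton_ext, mul_cyc_singleton_dom,
    Finset.mem_insert, Finset.mem_singleton]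
  constructor
  · rintro (rfl | rfl)
    · refine ⟨mul_cyc_singleton_ext _ _, ?_⟩
      rw [mul_cyc_singleton_dom]
      grind
    · refine ⟨rfl, ?_⟩
      grind
  · rintro ⟨h1, h2⟩
    have hjq : j ∈ q.dom := mem_dom_of_ext_ne (by rwa [h1])
    by_cases hnq : n ∈ q.dom
    · refine Or.inl (PartialPerm.eq_of_dom_ext ?_ (h1.trans (mul_cyc_singleton_ext _ _).symm))
      rw [mul_cyc_singleton_dom]
      grind
    · refine Or.inr (PartialPerm.eq_of_dom_ext ?_ h1)
      have h3 : ∀ x, x ∈ q.dom ∪ {j, n} ↔ x ∈ insert n u.dom := fun x => by rw [h2]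
      ext x
      have := h3 x
      simp only [Finset.mem_union, Finset.mem_insert, Finset.mem_singleton] at this
      grind

/-- Division by a transposition of two fixed points. -/
theorem coeff_mul_transposition_of_fixes (f : PartialPermAlgebra) {u : PartialPerm}
    {j n : ℕ+} (hjn : j ≠ n) (hj : j ∉ u.dom) (hn : n ∉ u.dom) :
    (f * single (transposition j n)).coeff (u * cyc [j] * cyc [n] * transposition j n) =
      f.coeff (u * cyc [j] * cyc [n]) + f.coeff (u * cyc [j]) + f.coeff (u * cyc [n])
        + f.coeff u := by
  classical
  have hdu : ∀ {p q : PartialPerm} (x : ℕ+), x ∈ p.dom → x ∉ q.dom → p ≠ q :=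
    fun x hp hq e => hq (e ▸ hp)
  have n1 : u * cyc [j] * cyc [n] ≠ u * cyc [j] := hdu n
    (by simp [mul_cyc_singleton_dom]) (by simp [mul_cyc_singleton_dom, hjn.symm, hn])
  have n2 : u * cyc [j] * cyc [n] ≠ u * cyc [n] := hdu j
    (by simp [mul_cyc_singleton_dom]) (by simp [mul_cyc_singleton_dom, hjn, hj])
  have n3 : u * cyc [j] * cyc [n] ≠ u := hdu j
    (by simp [mul_cyc_singleton_dom]) (by simp [hj])
  have n4 : u * cyc [j] ≠ u * cyc [n] := hdu j
    (by simp [mul_cyc_singleton_dom]) (by simp [mul_cyc_singleton_dom, hjn, hj])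
  have n5 : u * cyc [j] ≠ u := hdu j
    (by simp [mul_cyc_singleton_dom]) (by simp [hj])
  have n6 : u * cyc [n] ≠ u := hdu n
    (by simp [mul_cyc_singleton_dom]) (by simp [hn])
  -- Each of the two fixed points may independently be kept or omitted.
  rw [coeff_mul_single f {u * cyc [j] * cyc [n], u * cyc [j], u * cyc [n], u},
    Finset.sum_insert (by simp [n1, n2, n3]), Finset.sum_insert (by simp [n4, n5]),
    Finset.sum_pair n6]
  · ring
  intro q
  rw [mul_transposition_eq_iff (by simp [mul_cyc_singleton_dom])
    (by simp [mul_cyc_singleton_dom])]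
  simp only [mul_cyc_singleton_ext, mul_cyc_singleton_dom, Finset.mem_insert,
    Finset.mem_singleton]
  constructor
  · rintro (rfl | rfl | rfl | rfl) <;>
    · simp only [mul_cyc_singleton_ext, mul_cyc_singleton_dom]
      refine ⟨trivial, ?_⟩
      grind
  · rintro ⟨h1, h2⟩
    have h3 : ∀ x, (x ∈ q.dom ∨ x = j ∨ x = n) ↔ (x = n ∨ x = j ∨ x ∈ u.dom) := fun x => by
      have := congrArg (x ∈ ·) h2
      simp only [Finset.mem_union, Finset.mem_insert, Finset.mem_singleton, eq_iff_iff] at this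
      exact this
    have hset : ∀ {p : PartialPerm}, p.ext = u.ext → (∀ x, x ∈ q.dom ↔ x ∈ p.dom) → q = p :=
      fun hp hd => PartialPerm.eq_of_dom_ext (Finset.ext hd) (h1.trans hp.symm)
    by_cases hjq : j ∈ q.dom <;> by_cases hnq : n ∈ q.dom
    · refine Or.inl (hset (by simp only [mul_cyc_singleton_ext]) fun x => ?_)
      have := h3 x
      simp only [mul_cyc_singleton_dom, Finset.mem_insert]
      grind
    · refine Or.inr (Or.inl (hset (by simp only [mul_cyc_singleton_ext]) fun x => ?_))
      have := h3 x
      simp only [mul_cyc_singleton_dom, Finset.mem_insert]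
      grind
    · refine Or.inr (Or.inr (Or.inl (hset (by simp only [mul_cyc_singleton_ext]) fun x => ?_)))
      have := h3 x
      simp only [mul_cyc_singleton_dom, Finset.mem_insert]
      grind
    · refine Or.inr (Or.inr (Or.inr (hset rfl fun x => ?_)))
      have := h3 x
      grind

end PartialPermAlgebra

/-! ### Merging and splitting of cycles, and the recursion -/

namespace PartialPerm

/-- Two cycles merge when multiplied by a transposition of a point of each. -/
theorem cyc_mul_cyc_mul_transposition {a b : ℕ+} {l₁ l₂ : List ℕ+}
    (h : (a :: (l₁ ++ b :: l₂)).Nodup) :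
    cyc (b :: l₁) * cyc (a :: l₂) * transposition b a = cyc (a :: (l₁ ++ b :: l₂)) := by
  rw [transposition_comm]
  refine eq_of_dom_ext ?_ ?_
  · simp only [mul_dom, cyc_dom, transposition_dom]
    ext x
    simp only [Finset.mem_union, List.mem_toFinset, List.mem_cons, List.mem_append,
      Finset.mem_insert, Finset.mem_singleton]
    tauto
  · rw [mul_ext, mul_ext, cyc_ext, cyc_ext, cyc_ext, transposition_ext, formPerm_split h]

/-- A cycle splits when multiplied by a transposition of two of its points. -/
theorem cyc_mul_transposition {a b : ℕ+} {l₁ l₂ : List ℕ+} (h : (a :: (l₁ ++ b :: l₂)).Nodup) :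
    cyc (a :: (l₁ ++ b :: l₂)) * transposition a b = cyc (b :: l₁) * cyc (a :: l₂) := by
  refine eq_of_dom_ext ?_ ?_
  · simp only [mul_dom, cyc_dom, transposition_dom]
    ext x
    simp only [Finset.mem_union, List.mem_toFinset, List.mem_cons, List.mem_append,
      Finset.mem_insert, Finset.mem_singleton]
    tauto
  · rw [mul_ext, mul_ext, cyc_ext, cyc_ext, cyc_ext, transposition_ext, formPerm_split h,
      mul_assoc, Equiv.swap_mul_self, mul_one]

theorem mul_cyc_ext_ne {u : PartialPerm} {l : List ℕ+} (hl : l.Nodup) (h1 : 1 < l.length)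
    (h : Disjoint u.dom l.toFinset) {x : ℕ+} (hx : x ∈ l) : (u * cyc l).ext x ≠ x := by
  have hmem : l.formPerm x ∈ l := List.formPerm_apply_mem_of_mem hx
  have hu : l.formPerm x ∉ u.dom :=
    fun hd => Finset.disjoint_left.1 h hd (List.mem_toFinset.2 hmem)
  rw [mul_ext, cyc_ext, Equiv.Perm.mul_apply, u.ext_of_notMem hu]
  exact (List.formPerm_apply_mem_ne_self_iff l hl x hx).2 h1

end PartialPerm

namespace PartialPermAlgebra

open PartialPerm (transposition cyc)

/-- The merged cycle moves both `j` and `n`, so there is only one quotient. -/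
theorem coeff_mul_transposition_merge (f : PartialPermAlgebra) {v : PartialPerm} {j n : ℕ+}
    {l l' : List ℕ+} (hnd : (j :: (l ++ n :: l')).Nodup)
    (hv : Disjoint v.dom (j :: (l ++ n :: l')).toFinset) :
    (f * single (transposition j n)).coeff (v * cyc (j :: l') * cyc (n :: l)) =
      f.coeff (v * cyc (j :: (l ++ n :: l'))) := by
  have hdisj : Disjoint (cyc (j :: l')).dom (cyc (n :: l)).dom := by
    rw [PartialPerm.cyc_dom, PartialPerm.cyc_dom, Finset.disjoint_left]
    intro x
    simp only [List.mem_toFinset]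
    grind
  rw [mul_assoc v, PartialPerm.mul_comm_of_disjoint hdisj, ← PartialPerm.cyc_mul_transposition hnd,
    ← mul_assoc, coeff_mul_transposition_of_moves]
  · exact PartialPerm.mul_cyc_ext_ne hnd (by simp) hv (by simp)
  · exact PartialPerm.mul_cyc_ext_ne hnd (by simp) hv (by simp)

/-- The cycle of `n` is cut into two pieces, headed by `j` and `n`. An empty `l₁` makes `j` a fixed
point and an empty `l₂` makes `n` one; each conditional term is a quotient whose domain omits such
points. -/
theorem coeff_mul_transposition_split (f : PartialPermAlgebra) {u : PartialPerm} {j n : ℕ+}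
    {l₁ l₂ : List ℕ+} (hnd : (n :: (l₁ ++ j :: l₂)).Nodup)
    (hu : Disjoint u.dom (n :: (l₁ ++ j :: l₂)).toFinset) :
    (f * single (transposition j n)).coeff (u * cyc (n :: (l₁ ++ j :: l₂))) =
      f.coeff (u * cyc (j :: l₁) * cyc (n :: l₂))
        + (if l₁.length = 0 then f.coeff (u * cyc (n :: l₂)) else 0)
        + (if l₂.length = 0 then f.coeff (u * cyc (j :: l₁)) else 0)
        + (if l₁.length = 0 ∧ l₂.length = 0 then f.coeff u else 0) := by
  have hd : ∀ x ∈ n :: (l₁ ++ j :: l₂), x ∉ u.dom := fun x hx hxu =>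
    Finset.disjoint_left.1 hu hxu (List.mem_toFinset.2 hx)
  have hdisj : Disjoint (cyc (j :: l₁)).dom (cyc (n :: l₂)).dom := by
    rw [PartialPerm.cyc_dom, PartialPerm.cyc_dom, Finset.disjoint_left]
    intro x
    simp only [List.mem_toFinset]
    grind
  have hu1 : Disjoint u.dom (j :: l₁).toFinset := by
    rw [Finset.disjoint_right]
    intro x hx
    exact hd x (by simp at hx ⊢; tauto)
  have hu2 : Disjoint u.dom (n :: l₂).toFinset := by
    rw [Finset.disjoint_right]
    intro x hx
    exact hd x (by simp at hx ⊢; tauto)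
  have hnd1 : (j :: l₁).Nodup := by grind
  have hnd2 : (n :: l₂).Nodup := by grind
  have hjn : j ≠ n := by grind
  rw [← PartialPerm.cyc_mul_cyc_mul_transposition hnd, ← mul_assoc, ← mul_assoc]
  cases l₁ with
  | nil =>
    cases l₂ with
    | nil =>
      rw [coeff_mul_transposition_of_fixes f hjn (hd j (by simp)) (hd n (by simp))]
      simp only [List.length_nil, if_true, and_self]
      ring
    | cons b l₂ =>
      rw [mul_assoc u, PartialPerm.mul_comm_of_disjoint hdisj, ← mul_assoc,
        PartialPerm.transposition_comm, coeff_mul_transposition_of_fixes_right]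
      · simp
      · exact PartialPerm.mul_cyc_ext_ne hnd2 (by simp) hu2 (by simp)
      · rw [PartialPerm.mul_dom, Finset.mem_union, not_or]
        exact ⟨hd j (by simp), Finset.disjoint_left.1 hdisj (by simp [PartialPerm.cyc_dom])⟩
  | cons a l₁ =>
    cases l₂ with
    | nil =>
      rw [coeff_mul_transposition_of_fixes_right]
      · simp
      · exact PartialPerm.mul_cyc_ext_ne hnd1 (by simp) hu1 (by simp)
      · rw [PartialPerm.mul_dom, Finset.mem_union, not_or]
        exact ⟨hd n (by simp), Finset.disjoint_right.1 hdisj (by simp [PartialPerm.cyc_dom])⟩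
    | cons b l₂ =>
      rw [coeff_mul_transposition_of_moves]
      · simp
      · rw [mul_assoc, PartialPerm.mul_comm_of_disjoint hdisj, ← mul_assoc]
        refine PartialPerm.mul_cyc_ext_ne hnd1 (by simp) ?_ (by simp)
        rw [PartialPerm.mul_dom, Finset.disjoint_union_left]
        exact ⟨hu1, hdisj.symm⟩
      · refine PartialPerm.mul_cyc_ext_ne hnd2 (by simp) ?_ (by simp)
        rw [PartialPerm.mul_dom, Finset.disjoint_union_left]
        exact ⟨hu2, hdisj⟩

/-- The recursion for the class coefficients, for a part equal to `L + 1`. -/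
theorem IsClassExpansion.recursion {c : ℕ → Multiset ℕ+ → ℤ} (hc : IsClassExpansion c)
    (ρ : Multiset ℕ+) (k L : ℕ) :
    c (k + 1) (ρ + {L.succPNat}) =
      (ρ.map fun r : ℕ+ => (r : ℤ) * c k (ρ.erase r + {r + L.succPNat})).sum
        + ∑ i ∈ Finset.range L,
          (c k (ρ + {i.succPNat} + {(L - 1 - i).succPNat})
            + (if i = 0 then c k (ρ + {(L - 1 - i).succPNat}) else 0)
            + (if L - 1 - i = 0 then c k (ρ + {i.succPNat}) else 0)
            + (if i = 0 ∧ L - 1 - i = 0 then c k ρ else 0)) := by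
  obtain ⟨u, rfl⟩ := PartialPerm.exists_ptype_eq ρ
  obtain ⟨n, l, hnd, rfl, hdisj, hmax⟩ := PartialPerm.exists_fresh_list u.dom L
  have hcoeff := isClassExpansion_iff.1 hc
  have hdom : (u * cyc (n :: l)).dom.erase n = u.dom ∪ l.toFinset := by
    rw [PartialPerm.mul_dom, PartialPerm.cyc_dom]
    have h1 : n ∉ u.dom := Finset.disjoint_right.1 hdisj (by simp)
    ext x
    simp only [Finset.mem_erase, Finset.mem_union, List.mem_toFinset, List.mem_cons]
    grind
  have hdisj' : Disjoint u.dom l.toFinset :=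
    hdisj.mono_right fun x hx => by
      rw [List.mem_toFinset] at hx ⊢
      exact List.mem_cons_of_mem _ hx
  rw [← PartialPerm.ptype_mul_cyc hnd hdisj, ← hcoeff,
    coeff_completeJM_succ k (n := n) (by simp [PartialPerm.mul_dom, PartialPerm.cyc_dom]) hmax,
    hdom, Finset.sum_union hdisj']
  congr 1
  -- Points in other cycles: merging depends only on the length $r$ of the cycle of `j`, which has
  -- $r$ points.
  · refine PartialPerm.sum_dom_eq
      (fun r => c k (u.ptype.erase r + {r + l.length.succPNat})) _ u ?_
    rintro v j l' hnd' hv rfl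
    have hnd'' : (j :: (l ++ n :: l')).Nodup := by
      have : ∀ x ∈ j :: l', x ∉ n :: l := fun x hx hx' =>
        Finset.disjoint_left.1 hdisj (by
          rw [PartialPerm.mul_dom, PartialPerm.cyc_dom]
          exact Finset.mem_union_right _ (List.mem_toFinset.2 hx)) (List.mem_toFinset.2 hx')
      grind
    have hv' : Disjoint v.dom (j :: (l ++ n :: l')).toFinset := by
      rw [PartialPerm.mul_dom, Finset.disjoint_union_left] at hdisj
      rw [Finset.disjoint_left] at hv ⊢
      intro x hx
      have h1 := hv hx
      have h2 := Finset.disjoint_left.1 hdisj.1 hx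
      simp only [List.mem_toFinset, List.mem_cons, List.mem_append] at h1 h2 ⊢
      tauto
    rw [coeff_mul_transposition_merge _ hnd'' hv', hcoeff, PartialPerm.ptype_mul_cyc hnd'' hv',
      PartialPerm.ptype_mul_cyc hnd' hv]
    have h1 : (v.ptype + {l'.length.succPNat}).erase l'.length.succPNat = v.ptype := by
      rw [add_comm, Multiset.singleton_add, Multiset.erase_cons_head]
    have h2 : (l ++ n :: l').length.succPNat = l'.length.succPNat + l.length.succPNat := by
      apply PNat.coe_injective
      simp only [PNat.add_coe, Nat.succPNat_coe, List.length_append, List.length_cons]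
      omega
    rw [h1, h2]
  -- Points in the cycle of `n`: if `j` has $i$ points between `n` and itself, the pieces have
  -- lengths $i+1$ and $L-i$.
  · refine PartialPerm.sum_toFinset_eq_sum_range
      (fun a b => c k (u.ptype + {a.succPNat} + {b.succPNat})
        + (if a = 0 then c k (u.ptype + {b.succPNat}) else 0)
        + (if b = 0 then c k (u.ptype + {a.succPNat}) else 0)
        + (if a = 0 ∧ b = 0 then c k u.ptype else 0)) _ (List.nodup_cons.1 hnd).2 ?_
    rintro l₁ j l₂ rfl
    have hd : ∀ x ∈ n :: (l₁ ++ j :: l₂), x ∉ u.dom := fun x hx hxu =>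
      Finset.disjoint_left.1 hdisj hxu (List.mem_toFinset.2 hx)
    have hu1 : Disjoint u.dom (j :: l₁).toFinset := by
      rw [Finset.disjoint_right]
      intro x hx
      exact hd x (by simp at hx ⊢; tauto)
    have hu2 : Disjoint u.dom (n :: l₂).toFinset := by
      rw [Finset.disjoint_right]
      intro x hx
      exact hd x (by simp at hx ⊢; tauto)
    have hu3 : Disjoint (u * cyc (j :: l₁)).dom (n :: l₂).toFinset := by
      rw [PartialPerm.mul_dom, PartialPerm.cyc_dom, Finset.disjoint_union_left]
      refine ⟨hu2, ?_⟩
      rw [Finset.disjoint_left]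
      intro x
      simp only [List.mem_toFinset]
      grind
    have hnd1 : (j :: l₁).Nodup := by grind
    have hnd2 : (n :: l₂).Nodup := by grind
    rw [coeff_mul_transposition_split _ hnd hdisj, hcoeff, hcoeff, hcoeff, hcoeff,
      PartialPerm.ptype_mul_cyc hnd2 hu3, PartialPerm.ptype_mul_cyc hnd2 hu2,
      PartialPerm.ptype_mul_cyc hnd1 hu1]

theorem sum_range_eq_sum_filter_add_eq (F : ℕ+ → ℕ+ → ℤ) (L : ℕ) :
    ∑ i ∈ Finset.range L, F i.succPNat (L - 1 - i).succPNat =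
      ∑ x ∈ (Finset.Icc 1 L.succPNat ×ˢ Finset.Icc 1 L.succPNat).filter
        (fun x => x.1 + x.2 = L.succPNat), F x.1 x.2 := by
  have hmem : ∀ x : ℕ+ × ℕ+, x ∈ (Finset.Icc 1 L.succPNat ×ˢ Finset.Icc 1 L.succPNat).filter
      (fun x => x.1 + x.2 = L.succPNat) ↔ (x.1 : ℕ) + x.2 = L + 1 := by
    intro x
    simp only [Finset.mem_filter, Finset.mem_product, Finset.mem_Icc, one_le, true_and]
    rw [← PNat.coe_le_coe, ← PNat.coe_le_coe, ← PNat.coe_inj, PNat.add_coe, Nat.succPNat_coe]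
    omega
  refine Finset.sum_nbij' (fun i => (i.succPNat, (L - 1 - i).succPNat)) (fun x => x.1.natPred)
    ?_ ?_ ?_ ?_ ?_
  · intro i hi
    rw [Finset.mem_range] at hi
    rw [hmem, Nat.succPNat_coe, Nat.succPNat_coe]
    omega
  · intro x hx
    rw [hmem] at hx
    have h1 := x.1.natPred_add_one
    have h2 := x.2.pos
    rw [Finset.mem_range]
    omega
  · intro i _
    exact Nat.natPred_succPNat i
  · intro x hx
    rw [hmem] at hx
    have h1 := x.1.natPred_add_one
    refine Prod.ext (PNat.succPNat_natPred _) (PNat.coe_injective ?_)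
    rw [Nat.succPNat_coe]
    have h2 := x.2.pos
    omega
  · intro i _
    rfl

end PartialPermAlgebra

theorem mainTheorem5 :
    (∃! c : ℕ → Multiset ℕ+ → ℤ, PartialPermAlgebra.IsClassExpansion c) ∧
    ∀ c : ℕ → Multiset ℕ+ → ℤ, PartialPermAlgebra.IsClassExpansion c →
      ∀ (ρ : Multiset ℕ+) (k : ℕ), 1 ≤ k →
        (c k (ρ + {1}) =
          (ρ.map fun r : ℕ+ => (r : ℤ) * c (k - 1) (ρ.erase r + {r + 1})).sum) ∧
        (c k (ρ + {2}) =
          (ρ.map fun r : ℕ+ => (r : ℤ) * c (k - 1) (ρ.erase r + {r + 2})).sum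
            + c (k - 1) (ρ + {1, 1}) + 2 * c (k - 1) (ρ + {1}) + c (k - 1) ρ) ∧
        (∀ m : ℕ+, 3 ≤ m →
          c k (ρ + {m}) =
            (ρ.map fun r : ℕ+ => (r : ℤ) * c (k - 1) (ρ.erase r + {r + m})).sum
              + (∑ x ∈ (Finset.Icc 1 m ×ˢ Finset.Icc 1 m).filter (fun x => x.1 + x.2 = m),
                  c (k - 1) (ρ + {x.1, x.2}))
              + 2 * c (k - 1) (ρ + {m - 1})) := by
  refine ⟨PartialPermAlgebra.existsUnique_isClassExpansion, fun c hc ρ k hk => ?_⟩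
  obtain ⟨k, rfl⟩ : ∃ k', k = k' + 1 := ⟨k - 1, by omega⟩
  rw [Nat.add_sub_cancel]
  have hpair : ∀ a b : ℕ+, ρ + {a} + {b} = ρ + {a, b} := by
    intro a b
    rw [add_assoc]
    rfl
  have hone : Nat.succPNat 0 = 1 := rfl
  refine ⟨?_, ?_, fun m hm => ?_⟩
  -- The point `n` is alone in its cycle, so nothing can split.
  · have h := hc.recursion ρ k 0
    rwa [Finset.sum_range_zero, add_zero, hone] at h
  -- The only cut leaves two fixed points, so all four choices of domain occur; omitting either one
  -- gives the factor $2$.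
  · have h := hc.recursion ρ k 1
    rw [Finset.sum_range_one, show Nat.succPNat 1 = 2 from rfl] at h
    simp only [Nat.sub_self, hone, if_true, and_self, hpair] at h
    rw [h]
    ring
  · obtain ⟨L, rfl⟩ : ∃ L : ℕ, m = L.succPNat := ⟨m.natPred, m.succPNat_natPred.symm⟩
    have hL : 2 ≤ L := by
      have := PNat.coe_le_coe _ _ |>.2 hm
      rw [Nat.succPNat_coe] at this
      exact Nat.le_of_succ_le_succ this
    have hm1 : L.succPNat - 1 = (L - 1).succPNat := by
      apply PNat.coe_injective
      rw [PNat.sub_coe, if_pos (lt_of_lt_of_le (by decide) hm), Nat.succPNat_coe, Nat.succPNat_coe,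
        PNat.one_coe]
      omega
    rw [hc.recursion ρ k L, Finset.sum_add_distrib, Finset.sum_add_distrib,
      Finset.sum_add_distrib]
    -- A fixed point is cut off only at the two ends, $i=0$ and $i=L-1$. These are distinct since
    -- $L\ge 2$, so each yields one term with part $m-1$ and both pieces are never fixed points at
    -- once.
    have h1 : ∑ i ∈ Finset.range L,
        (if i = 0 then c k (ρ + {(L - 1 - i).succPNat}) else 0) = c k (ρ + {(L - 1).succPNat}) := by
      rw [Finset.sum_ite_eq_of_mem' _ _ _ (Finset.mem_range.2 (by omega)), Nat.sub_zero]
    have h2 : ∑ i ∈ Finset.range L,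
        (if L - 1 - i = 0 then c k (ρ + {i.succPNat}) else 0) = c k (ρ + {(L - 1).succPNat}) := by
      rw [Finset.sum_eq_single (L - 1), if_pos (Nat.sub_self _)]
      · intro i hi hne
        rw [Finset.mem_range] at hi
        exact if_neg (by omega)
      · intro h
        exact absurd (Finset.mem_range.2 (by omega)) h
    have h3 : ∑ i ∈ Finset.range L, (if i = 0 ∧ L - 1 - i = 0 then c k ρ else 0) = 0 :=
      Finset.sum_eq_zero fun i _ => if_neg (by omega)
    rw [h1, h2, h3, hm1,
      ← PartialPermAlgebra.sum_range_eq_sum_filter_add_eq (fun a b => c k (ρ + {a, b}))]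
    simp only [hpair]
    ring
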